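/- An edge-coloured graph is a finite simple graph together with an assignment of a colour to each of its edges (adjacent edges may have the same colour). Call it *restricted* if every colour is used on at most $3$ edges and, at every vertex, at most two edges of any given colour are incident. A *rainbow $\ell$-matching* in an edge-coloured graph is a set of $\ell$ pairwise vertex-disjoint edges whose colours are pairwise distinct. For integers $v\ge 2$ and $\ell\ge 1$, let $\mu_\ell(v)$ be the least integer $e\ge 0$ such that every restricted edge-coloured graph with $v$ vertices and at least $e$ edges contains a rainbow $\ell$-matching. (In particular, $\mu_\ell(v)=\binom v2+1$ if the complete graph on $v$ vertices has an edge-colouring that makes it a restricted graph without a rainbow $\ell$-matching.) Then - $\mu_1(v)=1$ for every $v\ge 2$; - $\mu_2(v)=7$ for $4\le v\le 6$; - $\mu_2(v)=v$ for every $v\ge 7$; - $\mu_3(6)=13$, $\mu_3(7)=15$, $\mu_3(8)=15$, $\mu_3(9)=16$ and $\mu_3(10)=18$. -/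

import Mathlib

/-! An edge-coloured graph on `v` vertices is a simple graph `G` on `Fin v` together with a map
`c : Sym2 (Fin v) → ℕ`, of which only the values on the edges of `G` are ever used.  Since there
are finitely many edges, taking the colours from `ℕ` is no restriction. -/

/-- The edge-coloured graph `(G, c)` is restricted: every colour is used on at most three edges,
and at every vertex at most two edges of any given colour are incident. -/
structure IsRestricted {v : ℕ} (G : SimpleGraph (Fin v)) (c : Sym2 (Fin v) → ℕ) : Prop where
  card_color_le : ∀ k : ℕ, {e | e ∈ G.edgeSet ∧ c e = k}.ncard ≤ 3
  card_incident_le : ∀ (x : Fin v) (k : ℕ), {e | e ∈ G.edgeSet ∧ x ∈ e ∧ c e = k}.ncard ≤ 2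

/-- `M` is a rainbow `l`-matching of `(G, c)`: a set of `l` edges of `G` such that any two
different members have no common vertex and have different colours. -/
structure IsRainbowMatching {v : ℕ} (G : SimpleGraph (Fin v)) (c : Sym2 (Fin v) → ℕ) (l : ℕ)
    (M : Finset (Sym2 (Fin v))) : Prop where
  subset_edgeSet : ∀ e ∈ M, e ∈ G.edgeSet
  card_eq : M.card = l
  disjoint : ∀ e ∈ M, ∀ f ∈ M, e ≠ f → ∀ x : Fin v, ¬ (x ∈ e ∧ x ∈ f)
  rainbow : ∀ e ∈ M, ∀ f ∈ M, e ≠ f → c e ≠ c f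

/-- Having at least `e` edges guarantees a rainbow `l`-matching in a restricted edge-coloured
graph on `v` vertices. -/
def ForcesRainbowMatching (l v e : ℕ) : Prop :=
  ∀ (G : SimpleGraph (Fin v)) (c : Sym2 (Fin v) → ℕ), IsRestricted G c →
    e ≤ G.edgeSet.ncard → ∃ M : Finset (Sym2 (Fin v)), IsRainbowMatching G c l M

/-- `mu l v` is the minimum number of edges that guarantees a rainbow `l`-matching in a restricted
edge-coloured graph on `v` vertices.  The number `v.choose 2 + 1` always qualifies, vacuously
(`forcesRainbowMatching_choose_two_add_one`), so this is the minimum of a nonempty set, and it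
equals `v.choose 2 + 1` if some restricted colouring of the complete graph on `v` vertices has no
rainbow `l`-matching (`mu_eq_choose_two_add_one`). -/
noncomputable def mu (l v : ℕ) : ℕ :=
  sInf {e : ℕ | ForcesRainbowMatching l v e}

theorem forcesRainbowMatching_choose_two_add_one (l v : ℕ) :
    ForcesRainbowMatching l v (v.choose 2 + 1) := by
  classical
  intro G c _ he
  have h := G.card_edgeFinset_le_card_choose_two
  rw [Fintype.card_fin, ← Set.ncard_coe_finset, SimpleGraph.coe_edgeFinset] at h
  omega

theorem mu_eq_choose_two_add_one (l v : ℕ) (c : Sym2 (Fin v) → ℕ)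
    (hc : IsRestricted (⊤ : SimpleGraph (Fin v)) c)
    (hM : ¬ ∃ M : Finset (Sym2 (Fin v)), IsRainbowMatching ⊤ c l M) :
    mu l v = v.choose 2 + 1 := by
  classical
  refine le_antisymm (Nat.sInf_le (forcesRainbowMatching_choose_two_add_one l v)) ?_
  refine le_csInf ⟨_, forcesRainbowMatching_choose_two_add_one l v⟩ fun e he => ?_
  by_contra hlt
  refine hM (he ⊤ c hc ?_)
  have h := SimpleGraph.card_edgeFinset_top_eq_card_choose_two (V := Fin v)
  rw [Fintype.card_fin, ← Set.ncard_coe_finset, SimpleGraph.coe_edgeFinset] at h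
  omega

/-! One edge is trivial. For two edges, suppose that there is no rainbow pair. If all edges pairwise
meet, there are at most `max 3 (v - 1)`. Otherwise two disjoint edges share a colour. An edge
leaving their four endpoints would exhaust that colour, so that every further edge must meet three
given edges, and at most five edges remain. Without such an edge the graph lies in a `K₄`. Stars and
the 1-factorised `K₄` are extremal.

For three edges, suppose that there is no rainbow triple, so every matching of size three has at
most two colours. If one has exactly two, number its vertices 0 to 5 and name its colours 0 and 1;
an exhaustive search with constraint propagation, evaluated by the kernel and proved sound in
`card_lt_of_refute`, bounds the number of edges.

If instead all matchings of size three are monochromatic (`IsRestricted.ncard_le_of_monochromatic`),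
take a rainbow pair, which the case of two edges provides. Every edge meets one of its four
endpoints, and since a colour has at most three edges, these endpoints send few edges outside. This
gives at most `max 12 (2 * v - 3)` edges.

The lower bounds come from all edges through `l - 1` fixed vertices with distinct colours, and from
explicit tables for small `v`. -/

/-! ### A verified search

Edges are bitmasks of two vertices, colours are encoded by powers of two, and sets of colours by
bitmasks. A search state consists of a list of edges with known colours and of two lists of
undecided edges, each with a bitmask of the colours that are still allowed. -/

/-- Remove from the colour set `m` of the edge `v` what the constraints `Q` forbid; a constraint
`(w, s)` says that every edge disjoint from `w` has its colour in `s`. -/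
def restrictColors (v : ℕ) : List (ℕ × ℕ) → ℕ → ℕ
  | [], m => m
  | (w, s) :: Q, m => restrictColors v Q (bif Nat.beq (Nat.land w v) 0 then Nat.land m s else m)

/-- Apply the constraints `Q` to all undecided edges, forbid the colour `b` on those that meet `t`,
and split the edges that remain possible by whether the colour `K` is allowed. -/
def sift (Q : List (ℕ × ℕ)) (t b K : ℕ) :
    List (ℕ × ℕ) → (List (ℕ × ℕ) → List (ℕ × ℕ) → Bool) → Bool
  | [], f => f [] []
  | (x, s) :: L, f =>
    match restrictColors x Q
      (bif Nat.beq (Nat.land t x) 0 then s else Nat.xor s (Nat.land s b)) with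
    | 0 => sift Q t b K L f
    | m + 1 =>
      -- `K` is the first unused colour and by symmetry stands for all unused ones: an edge that
      -- cannot have it must have a used colour.
      bif Nat.beq (Nat.land (m + 1) K) 0 then sift Q t b K L fun H C => f ((x, m + 1) :: H) C
      else sift Q t b K L fun H C => f H ((x, m + 1) :: C)

/-- The constraints that result from giving colour `b` to the edge `v`. -/
def conflicts (v b : ℕ) :
    List (ℕ × ℕ) → ℕ → ℕ → List (ℕ × ℕ) → (List (ℕ × ℕ) → ℕ → Bool) → Bool
  -- `n` counts the edges of colour `b`, including `v`. At three the colour is exhausted, and 1023,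
  -- the set of ten vertices, forbids it everywhere.
  | [], n, t, Q, f => bif Nat.ble 3 n then f Q 1023 else f Q t
  | (w, d) :: E, n, t, Q, f =>
    bif Nat.beq d b then conflicts v b E (n + 1) (Nat.lor t (Nat.land v w)) Q f
    else bif Nat.beq (Nat.land w v) 0 then
      conflicts v b E n t ((Nat.lor w v, Nat.lor d b) :: Q) f
    else conflicts v b E n t Q f

/-- Continue with the lists of undecided edges that result from giving colour `b` to `v`. -/
def assign (v b K : ℕ) (E hot cold : List (ℕ × ℕ))
    (f : List (ℕ × ℕ) → List (ℕ × ℕ) → Bool) : Bool :=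
  conflicts v b E 1 0 [] fun Q t => sift Q t b K cold fun H C => sift Q t b K hot fun H' C' =>
    f (H ++ H') (C' ++ C)

/-- Check `g` for the first `n` colours from `b` on that belong to `m`. -/
def allColors (g : ℕ → Bool) (m : ℕ) : ℕ → ℕ → Bool
  | 0, _ => true
  | n + 1, b => (bif Nat.beq (Nat.land m b) 0 then true else g b) && allColors g m n (Nat.mul 2 b)

/-- Whether `L.length + n < need`. -/
def isShort (need : ℕ) : List (ℕ × ℕ) → ℕ → Bool
  | [], n => Nat.blt n need
  | _ :: L, n => isShort need L (n + 1)

/-- Search for a completion with `need` edges; `true` means that there is none. -/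
def refute (need : ℕ) : ℕ → ℕ → ℕ → List (ℕ × ℕ) → List (ℕ × ℕ) → List (ℕ × ℕ) → Bool
  | 0, _, _, _, _, _ => false
  | n + 1, k, K, E, hot, cold =>
    -- The `k` used colours account for at most `3 * k` edges, and only edges in `cold` can have
    -- another colour.
    bif isShort need cold (3 * k) then true else
    bif isShort need cold (E.length + hot.length) then true else
    match hot with
    | (x, s) :: hot =>
      allColors (fun b => assign x b K E hot cold (refute need n k K ((x, b) :: E))) s k 1 &&
        refute need n k K E hot cold
    | [] =>
      match cold with
      | [] => false
      | (x, s) :: cold =>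
        allColors (fun b =>
          bif Nat.beq b K then
            assign x b (Nat.mul 2 K) E [] cold
              (refute need n (k + 1) (Nat.mul 2 K) ((x, b) :: E))
          else assign x b K E [] cold (refute need n k K ((x, b) :: E))) s (k + 1) 1 &&
        refute need n k K E [] cold

/-- The bitmasks of the pairs of vertices below `n`, in decreasing order. -/
def pairMasks (n : ℕ) : List ℕ :=
  (List.range n).reverse.flatMap fun j => (List.range j).reverse.map fun i => 2 ^ j + 2 ^ i

/-- All edges on `n` vertices other than `{0, 1}`, `{2, 3}` and `{4, 5}`, with all colours
allowed. -/
def undecided (n : ℕ) : List (ℕ × ℕ) :=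
  ((pairMasks n).filter fun x => x ∉ [48, 12, 3]).map fun x => (x, 2 ^ 60 - 1)

/-- Search for a graph with `need` edges on `n` vertices in which `{0, 1}` and `{2, 3}` have colour
`0` and `{4, 5}` has colour `1`. -/
def refuteStart (n need : ℕ) : Bool :=
  assign 48 2 4 [(12, 1), (3, 1)] [] (undecided n)
    (refute need 50 2 4 [(48, 2), (12, 1), (3, 1)])

/-! ### What a search state asserts about an edge set -/

/-- `c` is a colouring, with colours below `60`, of the edges with masks in `P` which belongs to a
restricted graph without a rainbow matching of size three. -/
structure IsAdmissible (P : Finset ℕ) (c : ℕ → ℕ) : Prop where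
  lt : ∀ x ∈ P, c x < 60
  rainbow : ∀ x ∈ P, ∀ y ∈ P, ∀ z ∈ P, x &&& y = 0 → x &&& z = 0 → y &&& z = 0 →
    c x = c y ∨ c x = c z ∨ c y = c z
  card_le : ∀ d, ∀ s ⊆ P, (∀ x ∈ s, c x = d) → s.card ≤ 3
  incident : ∀ x ∈ P, ∀ y ∈ P, ∀ z ∈ P, x ≠ y → x ≠ z → y ≠ z → c x = c y → c x = c z →
    x &&& y &&& z = 0

/-- The colouring `c` agrees with the decisions in `E`. -/
structure IsConsistent (P : Finset ℕ) (E : List (ℕ × ℕ)) (c : ℕ → ℕ) : Prop where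
  nodup : (E.map Prod.fst).Nodup
  mem : ∀ q ∈ E, q.1 ∈ P
  eq : ∀ q ∈ E, q.2 = 2 ^ c q.1

/-- The undecided edge `e` is treated correctly: no admissible colouring that agrees with the
decisions in `E` gives a forbidden colour to `e`. -/
def IsSound (P : Finset ℕ) (E : List (ℕ × ℕ)) (e : ℕ × ℕ) : Prop :=
  ∀ c, IsAdmissible P c → IsConsistent P E c → e.1 ∈ P → e.1 ∉ E.map Prod.fst →
    e.2 &&& 2 ^ c e.1 ≠ 0

/-- The state given by `E`, `hot` and `cold`, in which the first `k` colours are used, describes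
the edge set `P`. -/
structure IsState (P : Finset ℕ) (k : ℕ) (E hot cold : List (ℕ × ℕ)) : Prop where
  used : ∀ q ∈ E, ∃ d < k, q.2 = 2 ^ d
  hot_sound : ∀ e ∈ hot, IsSound P E e
  cold_sound : ∀ e ∈ cold, IsSound P E e
  hot_lt : ∀ c, IsAdmissible P c → IsConsistent P E c → ∀ e ∈ hot, e.1 ∈ P →
    e.1 ∉ E.map Prod.fst → c e.1 < k
  covers : ∀ c, IsAdmissible P c → IsConsistent P E c → ∀ x ∈ P,
    x ∈ E.map Prod.fst ∨ x ∈ hot.map Prod.fst ∨ x ∈ cold.map Prod.fst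

theorem and_two_pow_eq_zero_iff (m d : ℕ) : m &&& 2 ^ d = 0 ↔ m.testBit d = false := by
  rw [Nat.and_two_pow]
  cases m.testBit d <;> simp

theorem and_two_pow_ne_zero_iff (m d : ℕ) : m &&& 2 ^ d ≠ 0 ↔ m.testBit d = true := by
  rw [Ne, and_two_pow_eq_zero_iff]
  simp

theorem IsAdmissible.swap {P : Finset ℕ} {c : ℕ → ℕ} (h : IsAdmissible P c) {k d : ℕ}
    (hk : k < 60) (hd : d < 60) : IsAdmissible P (Equiv.swap k d ∘ c) where
  lt x hx := by
    have := h.lt x hx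
    simp only [Function.comp, Equiv.swap_apply_def]
    split_ifs <;> omega
  rainbow x hx y hy z hz h1 h2 h3 := by
    simpa using h.rainbow x hx y hy z hz h1 h2 h3
  card_le e s hs he := h.card_le (Equiv.swap k d e) s hs fun x hx => by
    rw [← he x hx]; simp
  incident x hx y hy z hz h1 h2 h3 h4 h5 :=
    h.incident x hx y hy z hz h1 h2 h3 (by simpa using h4) (by simpa using h5)

/-- Decided edges have colours below `k`, which the swap fixes. So unused colours are
interchangeable, the only symmetry that the search exploits. -/
theorem IsConsistent.swap {P : Finset ℕ} {E : List (ℕ × ℕ)} {c : ℕ → ℕ} (h : IsConsistent P E c)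
    {k d : ℕ} (hE : ∀ q ∈ E, ∃ i < k, q.2 = 2 ^ i) (hd : k ≤ d) :
    IsConsistent P E (Equiv.swap k d ∘ c) where
  nodup := h.nodup
  mem := h.mem
  eq q hq := by
    obtain ⟨i, hi, hqi⟩ := hE q hq
    have : i = c q.1 := Nat.pow_right_injective le_rfl (hqi.symm.trans (h.eq q hq))
    rw [hqi, Function.comp, ← this, Equiv.swap_apply_of_ne_of_ne (by omega) (by omega)]

/-! ### Soundness of constraint propagation -/

theorem restrictColors_and_ne_zero {v d : ℕ} {Q : List (ℕ × ℕ)} {m : ℕ} (hm : m &&& 2 ^ d ≠ 0)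
    (hQ : ∀ q ∈ Q, q.1 &&& v = 0 → q.2 &&& 2 ^ d ≠ 0) : restrictColors v Q m &&& 2 ^ d ≠ 0 := by
  induction Q generalizing m with
  | nil => exact hm
  | cons q Q ih =>
    rw [restrictColors]
    refine ih ?_ fun q hq => hQ q (List.mem_cons_of_mem _ hq)
    cases h : Nat.beq (Nat.land q.1 v) 0 with
    | false => exact hm
    | true =>
      have h' := hQ q List.mem_cons_self (Nat.eq_of_beq_eq_true h)
      rw [and_two_pow_ne_zero_iff] at hm h' ⊢
      change (m &&& q.2).testBit d = true
      rw [Nat.testBit_land, hm, h']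
      rfl

/-- An edge whose colour set becomes empty may be dropped: if it were in `P`, its colour would
belong to that set. -/
theorem exists_sift {P : Finset ℕ} {E : List (ℕ × ℕ)} {Q : List (ℕ × ℕ)} {t g k : ℕ}
    {L : List (ℕ × ℕ)}
    (hQ : ∀ c, IsAdmissible P c → IsConsistent P E c → ∀ x ∈ P, x ∉ E.map Prod.fst →
      (∀ q ∈ Q, q.1 &&& x = 0 → q.2 &&& 2 ^ c x ≠ 0) ∧ (t &&& x ≠ 0 → c x ≠ g))
    (hL : ∀ e ∈ L, IsSound P E e) (f : List (ℕ × ℕ) → List (ℕ × ℕ) → Bool) :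
    ∃ H C, sift Q t (2 ^ g) (2 ^ k) L f = f H C ∧ (∀ e ∈ H, IsSound P E e) ∧
      (∀ e ∈ C, IsSound P E e) ∧ (∀ e ∈ H, e.2 &&& 2 ^ k = 0) ∧
      ∀ c, IsAdmissible P c → IsConsistent P E c → ∀ x ∈ P, x ∉ E.map Prod.fst →
        x ∈ L.map Prod.fst → x ∈ H.map Prod.fst ∨ x ∈ C.map Prod.fst := by
  induction L generalizing f with
  | nil => exact ⟨[], [], rfl, by simp, by simp, by simp, by simp⟩
  | cons e L ih =>
    have hL' : ∀ e ∈ L, IsSound P E e := fun e he => hL e (List.mem_cons_of_mem _ he)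
    have key : IsSound P E (e.1, restrictColors e.1 Q
        (bif Nat.beq (Nat.land t e.1) 0 then e.2
          else Nat.xor e.2 (Nat.land e.2 (2 ^ g)))) := by
      intro c hc hE hx hx'
      obtain ⟨h1, h2⟩ := hQ c hc hE e.1 hx hx'
      refine restrictColors_and_ne_zero ?_ h1
      have h3 := hL e List.mem_cons_self c hc hE hx hx'
      cases h : Nat.beq (Nat.land t e.1) 0 with
      | true => exact h3
      | false =>
        have h4 := h2 (Nat.ne_of_beq_eq_false h)
        rw [and_two_pow_ne_zero_iff] at h3 ⊢
        change (e.2 ^^^ (e.2 &&& 2 ^ g)).testBit (c e.1) = true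
        rw [Nat.testBit_xor, Nat.testBit_land, h3, Nat.testBit_two_pow_of_ne (Ne.symm h4)]
        rfl
    rw [sift]
    split
    · next h0 =>
      rw [h0] at key
      obtain ⟨H, C, h1, h2, h3, h4, h5⟩ := ih hL' f
      refine ⟨H, C, h1, h2, h3, h4, fun c hc hE x hx hxE hxL => ?_⟩
      rw [List.map_cons, List.mem_cons] at hxL
      rcases hxL with rfl | hxL
      · exact absurd (Nat.zero_and _) (key c hc hE hx hxE)
      · exact h5 c hc hE x hx hxE hxL
    · next m h0 =>
      rw [h0] at key
      cases h : Nat.beq (Nat.land (m + 1) (2 ^ k)) 0 with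
      | true =>
        obtain ⟨H, C, h1, h2, h3, h4, h5⟩ := ih hL' fun H C => f ((e.1, m + 1) :: H) C
        refine ⟨(e.1, m + 1) :: H, C, h1, ?_, h3, ?_, fun c hc hE x hx hxE hxL => ?_⟩
        · simpa [List.forall_mem_cons] using ⟨key, by simpa using h2⟩
        · rw [List.forall_mem_cons]
          exact ⟨Nat.eq_of_beq_eq_true h, h4⟩
        · rw [List.map_cons, List.mem_cons] at hxL ⊢
          rcases hxL with rfl | hxL
          · exact Or.inl (Or.inl rfl)
          · exact (h5 c hc hE x hx hxE hxL).imp_left Or.inr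
      | false =>
        obtain ⟨H, C, h1, h2, h3, h4, h5⟩ := ih hL' fun H C => f H ((e.1, m + 1) :: C)
        refine ⟨H, (e.1, m + 1) :: C, h1, h2, ?_, h4, fun c hc hE x hx hxE hxL => ?_⟩
        · simpa [List.forall_mem_cons] using ⟨key, by simpa using h3⟩
        · rw [List.map_cons, List.mem_cons] at hxL
          rw [List.map_cons, List.mem_cons]
          rcases hxL with rfl | hxL
          · exact Or.inr (Or.inl rfl)
          · exact (h5 c hc hE x hx hxE hxL).imp_right Or.inr

/-- `R` and `T` stay abstract because the induction only needs that each decided edge preserves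
them; `exists_assign` takes them to be validity in all colourings that agree with the decisions. -/
theorem exists_conflicts {v g : ℕ} {E : List (ℕ × ℕ)} {R : ℕ → ℕ → Prop} {T : ℕ → Prop}
    (f : List (ℕ × ℕ) → ℕ → Bool) (n t : ℕ) (Q : List (ℕ × ℕ))
    (hR : ∀ q ∈ E, q.2 ≠ 2 ^ g → q.1 &&& v = 0 → R (q.1 ||| v) (q.2 ||| 2 ^ g))
    (hQ : ∀ q ∈ Q, R q.1 q.2)
    (hT : 3 ≤ n + (E.filter fun q => q.2 = 2 ^ g).length → T 1023)
    (ht : T t) (hT' : ∀ q ∈ E, q.2 = 2 ^ g → ∀ t, T t → T (t ||| (v &&& q.1))) :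
    ∃ Q' t', conflicts v (2 ^ g) E n t Q f = f Q' t' ∧ (∀ q ∈ Q', R q.1 q.2) ∧ T t' := by
  induction E generalizing n t Q with
  | nil =>
    rw [conflicts]
    cases h : Nat.ble 3 n with
    | true => exact ⟨Q, 1023, rfl, hQ, hT (Nat.le_of_ble_eq_true h)⟩
    | false => exact ⟨Q, t, rfl, hQ, ht⟩
  | cons q E ih =>
    have hR' : ∀ q ∈ E, q.2 ≠ 2 ^ g → q.1 &&& v = 0 → R (q.1 ||| v) (q.2 ||| 2 ^ g) :=
      fun q hq => hR q (List.mem_cons_of_mem _ hq)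
    have hT'' : ∀ q ∈ E, q.2 = 2 ^ g → ∀ t, T t → T (t ||| (v &&& q.1)) :=
      fun q hq => hT' q (List.mem_cons_of_mem _ hq)
    rw [conflicts]
    cases h : Nat.beq q.2 (2 ^ g) with
    | true =>
      have h' := Nat.eq_of_beq_eq_true h
      refine ih _ _ Q hR' hQ (fun h3 => hT ?_) (hT' q List.mem_cons_self h' t ht) hT''
      rw [List.filter_cons_of_pos (by simpa using h'), List.length_cons]
      omega
    | false =>
      have h' := Nat.ne_of_beq_eq_false h
      have hT3 : 3 ≤ n + (E.filter fun q => q.2 = 2 ^ g).length → T 1023 := fun h3 => hT (by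
        rwa [List.filter_cons_of_neg (by simpa using h')])
      cases h0 : Nat.beq (Nat.land q.1 v) 0 with
      | true =>
        refine ih n t _ hR' ?_ hT3 ht hT''
        rw [List.forall_mem_cons]
        exact ⟨hR q List.mem_cons_self h' (Nat.eq_of_beq_eq_true h0), hQ⟩
      | false => exact ih n t Q hR' hQ hT3 ht hT''

/-- Two disjoint edges of different colours force any edge disjoint from both into one of these
colours, which validates the constraints. Taking `k'` larger than `k` allows `g` to be a new colour.
-/
theorem exists_assign {P : Finset ℕ} {E hot₀ cold₀ hot cold : List (ℕ × ℕ)} {k k' v g : ℕ}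
    (hS : IsState P k E hot₀ cold₀) (hhot : hot ⊆ hot₀) (hcold : cold ⊆ cold₀)
    (hcov₀ : ∀ x, x ∈ hot₀.map Prod.fst ∨ x ∈ cold₀.map Prod.fst →
      x = v ∨ x ∈ hot.map Prod.fst ∨ x ∈ cold.map Prod.fst) (hk : k ≤ k') (hg : g < k')
    (f : List (ℕ × ℕ) → List (ℕ × ℕ) → Bool) :
    ∃ H C, assign v (2 ^ g) (2 ^ k') E hot cold f = f H C ∧
      IsState P k' ((v, 2 ^ g) :: E) H C := by
  have hcons : ∀ c, IsConsistent P ((v, 2 ^ g) :: E) c → IsConsistent P E c := fun c hc =>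
    ⟨(List.nodup_cons.1 hc.nodup).2, fun q hq => hc.mem q (List.mem_cons_of_mem _ hq),
      fun q hq => hc.eq q (List.mem_cons_of_mem _ hq)⟩
  have hcol : ∀ c, IsConsistent P ((v, 2 ^ g) :: E) c → c v = g := fun c hc =>
    (Nat.pow_right_injective le_rfl (hc.eq (v, 2 ^ g) List.mem_cons_self)).symm
  have hmono : ∀ e, IsSound P E e → IsSound P ((v, 2 ^ g) :: E) e := fun e he c hc hE hx hx' =>
    he c hc (hcons c hE) hx fun h => hx' (List.mem_cons_of_mem _ h)
  obtain ⟨Q, t, h1, hQ, hT⟩ := exists_conflicts (v := v) (g := g) (E := E)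
    (R := fun w s => ∀ c, IsAdmissible P c → IsConsistent P ((v, 2 ^ g) :: E) c → ∀ x ∈ P,
      w &&& x = 0 → s &&& 2 ^ c x ≠ 0)
    (T := fun t => ∀ c, IsAdmissible P c → IsConsistent P ((v, 2 ^ g) :: E) c → ∀ x ∈ P,
      x ∉ ((v, 2 ^ g) :: E).map Prod.fst → t &&& x ≠ 0 → c x ≠ g)
    (fun Q t => sift Q t (2 ^ g) (2 ^ k') cold fun H C =>
      sift Q t (2 ^ g) (2 ^ k') hot fun H' C' => f (H ++ H') (C' ++ C)) 1 0 []
    (by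
      intro q hq hqg hqv c hc hE x hx hqx
      have hq1 := (hcons c hE).mem q hq
      have hv : v ∈ P := hE.mem (v, 2 ^ g) List.mem_cons_self
      rw [Nat.and_or_distrib_right] at hqx
      obtain ⟨hqx, hvx⟩ := Nat.or_eq_zero_iff.1 hqx
      have hqc := (hcons c hE).eq q hq
      rw [and_two_pow_ne_zero_iff, Nat.testBit_lor, hqc, Nat.testBit_two_pow, Nat.testBit_two_pow]
      rcases hc.rainbow _ hq1 _ hv _ hx hqv hqx hvx with h | h | h
      · exact absurd (hqc.trans (by rw [h, hcol c hE])) hqg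
      · simp [h]
      · simp [← h, hcol c hE])
    (by simp)
    (by
      intro h3 c hc hE x hx hxE _ hcx
      classical
      -- If `x` also had colour `g`, then `x`, `v` and the at least two edges of `F` would be four
      -- edges of one colour.
      set F := E.filter fun q => q.2 = 2 ^ g with hF
      have hsub : F.map Prod.fst ⊆ E.map Prod.fst := List.map_subset _ (List.filter_subset_self _)
      have hnd : (x :: v :: F.map Prod.fst).Nodup := by
        have := hE.nodup
        rw [List.map_cons, List.nodup_cons] at this
        rw [List.map_cons, List.mem_cons, not_or] at hxE
        rw [List.nodup_cons, List.nodup_cons, List.mem_cons, not_or]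
        exact ⟨⟨hxE.1, fun h => hxE.2 (hsub h)⟩, fun h => this.1 (hsub h),
          this.2.sublist ((List.filter_sublist).map _)⟩
      have hcard := hc.card_le g (x :: v :: F.map Prod.fst).toFinset ?_ ?_
      · rw [List.toFinset_card_of_nodup hnd] at hcard
        simp only [List.length_cons, List.length_map] at hcard
        omega
      · intro y hy
        simp only [List.mem_toFinset, List.mem_cons, List.mem_map] at hy
        rcases hy with rfl | rfl | ⟨q, hq, rfl⟩
        · exact hx
        · exact hE.mem (y, 2 ^ g) List.mem_cons_self
        · exact (hcons c hE).mem q (List.mem_filter.1 hq).1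
      · intro y hy
        simp only [List.mem_toFinset, List.mem_cons, List.mem_map] at hy
        rcases hy with rfl | rfl | ⟨q, hq, rfl⟩
        · exact hcx
        · exact hcol c hE
        · obtain ⟨hq, hqg⟩ := List.mem_filter.1 hq
          exact Nat.pow_right_injective le_rfl
            (((hcons c hE).eq q hq).symm.trans (of_decide_eq_true hqg)))
    (by simp)
    (by
      intro q hq hqg t ht c hc hE x hx hxE htx hcx
      rw [Nat.and_or_distrib_right, Ne, Nat.or_eq_zero_iff, not_and] at htx
      have h0 : t &&& x = 0 := by
        by_contra h
        exact ht c hc hE x hx hxE h hcx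
      have hq1 := (hcons c hE).mem q hq
      have hv : v ∈ P := hE.mem (v, 2 ^ g) List.mem_cons_self
      have hmem : q.1 ∈ E.map Prod.fst := List.mem_map_of_mem hq
      have hnd := hE.nodup
      rw [List.map_cons, List.nodup_cons] at hnd
      rw [List.map_cons, List.mem_cons, not_or] at hxE
      have hqc : c q.1 = g :=
        Nat.pow_right_injective le_rfl (((hcons c hE).eq q hq).symm.trans hqg)
      refine htx h0 (hc.incident v hv q.1 hq1 x hx ?_ (Ne.symm hxE.1) ?_ ?_ ?_)
      · rintro rfl
        exact hnd.1 hmem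
      · rintro rfl
        exact hxE.2 hmem
      · rw [hcol c hE, hqc]
      · rw [hcol c hE, hcx])
  have hsift : ∀ c, IsAdmissible P c → IsConsistent P ((v, 2 ^ g) :: E) c → ∀ x ∈ P,
      x ∉ ((v, 2 ^ g) :: E).map Prod.fst →
      (∀ q ∈ Q, q.1 &&& x = 0 → q.2 &&& 2 ^ c x ≠ 0) ∧ (t &&& x ≠ 0 → c x ≠ g) :=
    fun c hc hE x hx hxE => ⟨fun q hq => hQ q hq c hc hE x hx, hT c hc hE x hx hxE⟩
  obtain ⟨H, C, h2, hH, hC, hHk, hcov⟩ := exists_sift (k := k') hsift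
    (fun e he => hmono e (hS.cold_sound e (hcold he)))
    (fun H C => sift Q t (2 ^ g) (2 ^ k') hot fun H' C' => f (H ++ H') (C' ++ C))
  obtain ⟨H', C', h3, hH', hC', hHk', hcov'⟩ := exists_sift (k := k') hsift
    (fun e he => hmono e (hS.hot_sound e (hhot he))) (fun H' C' => f (H ++ H') (C' ++ C))
  have hused : ∀ q ∈ (v, 2 ^ g) :: E, ∃ d < k', q.2 = 2 ^ d := by
    rw [List.forall_mem_cons]
    refine ⟨⟨g, hg, rfl⟩, fun q hq => ?_⟩
    obtain ⟨d, hd, h⟩ := hS.used q hq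
    exact ⟨d, hd.trans_le hk, h⟩
  have hHs : ∀ e ∈ H ++ H', IsSound P ((v, 2 ^ g) :: E) e := fun e he =>
    (List.mem_append.1 he).elim (hH e) (hH' e)
  refine ⟨H ++ H', C' ++ C, h1.trans (h2.trans h3), hused, hHs, fun e he =>
    (List.mem_append.1 he).elim (hC' e) (hC e), fun c hc hE e he hx hxE => ?_, fun c hc hE x hx => ?_⟩
  -- Swapping an unused colour of `e` with `k'` would give a valid colouring in which `e` has the
  -- colour `k'`, which its colour set excludes.
  · by_contra hlt
    rw [not_lt] at hlt
    have hbit : e.2 &&& 2 ^ k' = 0 := (List.mem_append.1 he).elim (hHk e) (hHk' e)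
    have := hHs e he _ (hc.swap (hlt.trans_lt (hc.lt _ hx)) (hc.lt _ hx)) (hE.swap hused hlt) hx hxE
    rw [Function.comp, Equiv.swap_apply_right] at this
    exact this hbit
  · by_cases hxE : x ∈ ((v, 2 ^ g) :: E).map Prod.fst
    · exact Or.inl hxE
    · rw [List.map_append, List.map_append, List.mem_append, List.mem_append]
      rcases hS.covers c hc (hcons c hE) x hx with h | h
      · exact absurd (List.mem_cons_of_mem _ h) hxE
      rcases hcov₀ x h with rfl | h | h
      · exact absurd List.mem_cons_self hxE
      · have := hcov' c hc hE x hx hxE h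
        tauto
      · have := hcov c hc hE x hx hxE h
        tauto

/-! ### Correctness of the recursion -/

theorem isShort_eq (need : ℕ) (L : List (ℕ × ℕ)) (n : ℕ) :
    isShort need L n = Nat.blt (L.length + n) need := by
  induction L generalizing n with
  | nil => simp [isShort]
  | cons e L ih => rw [isShort, ih, List.length_cons, Nat.add_right_comm, Nat.add_assoc]

theorem allColors_apply {g : ℕ → Bool} {m n i d : ℕ} (h : allColors g m n (2 ^ i) = true)
    (hid : i ≤ d) (hd : d < i + n) (hm : m &&& 2 ^ d ≠ 0) : g (2 ^ d) = true := by
  induction n generalizing i with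
  | zero => omega
  | succ n ih =>
    rw [allColors, Bool.and_eq_true] at h
    rcases hid.eq_or_lt with rfl | hlt
    · have h1 := h.1
      cases h0 : Nat.beq (Nat.land m (2 ^ i)) 0 with
      | true => exact absurd (Nat.eq_of_beq_eq_true h0) hm
      | false => rwa [h0] at h1
    · have h2 := h.2
      rw [show Nat.mul 2 (2 ^ i) = 2 ^ (i + 1) from (pow_succ' 2 i).symm] at h2
      exact ih h2 hlt (by omega)

theorem IsState.absent {P : Finset ℕ} {k : ℕ} {E hot cold hot' cold' : List (ℕ × ℕ)} {e : ℕ × ℕ}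
    (hS : IsState P k E hot cold) (hH : hot' ⊆ hot) (hC : cold' ⊆ cold)
    (hcov : ∀ x, x ∈ hot.map Prod.fst ∨ x ∈ cold.map Prod.fst →
      x = e.1 ∨ x ∈ hot'.map Prod.fst ∨ x ∈ cold'.map Prod.fst)
    (he : e.1 ∈ P → e.1 ∈ E.map Prod.fst) : IsState P k E hot' cold' where
  used := hS.used
  hot_sound e he := hS.hot_sound e (hH he)
  cold_sound e he := hS.cold_sound e (hC he)
  hot_lt c hc hE e he := hS.hot_lt c hc hE e (hH he)
  covers c hc hE x hx := by
    rcases hS.covers c hc hE x hx with h | h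
    · exact Or.inl h
    · rcases hcov x h with rfl | h
      · exact Or.inl (he hx)
      · exact Or.inr h

theorem IsConsistent.cons {P : Finset ℕ} {E : List (ℕ × ℕ)} {c : ℕ → ℕ} (h : IsConsistent P E c)
    {x : ℕ} (hx : x ∈ P) (hxE : x ∉ E.map Prod.fst) : IsConsistent P ((x, 2 ^ c x) :: E) c where
  nodup := List.nodup_cons.2 ⟨hxE, h.nodup⟩
  mem := List.forall_mem_cons.2 ⟨hx, h.mem⟩
  eq := List.forall_mem_cons.2 ⟨rfl, h.eq⟩

/-- Induction on the fuel, following the branch that matches `P` and `c`. The colouring must be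
generalised, since a new colour is renamed to `k` on the way. -/
theorem card_lt_of_refute {need : ℕ} {P : Finset ℕ} {n k : ℕ} {E hot cold : List (ℕ × ℕ)}
    (h : refute need n k (2 ^ k) E hot cold = true) (hS : IsState P k E hot cold) {c : ℕ → ℕ}
    (hc : IsAdmissible P c) (hE : IsConsistent P E c) : P.card < need := by
  classical
  induction n generalizing k E hot cold c with
  | zero => simp [refute] at h
  | succ n ih =>
    rw [refute.eq_def] at h
    simp only [isShort_eq] at h
    cases h1 : Nat.blt (cold.length + 3 * k) need with
    | true =>
      refine lt_of_le_of_lt ?_ (Nat.le_of_ble_eq_true h1)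
      have hsub : P ⊆ (P.filter fun x => c x < k) ∪ (cold.map Prod.fst).toFinset := by
        intro x hx
        rw [Finset.mem_union, Finset.mem_filter, List.mem_toFinset]
        by_cases hxE : x ∈ E.map Prod.fst
        · obtain ⟨q, hq, rfl⟩ := List.mem_map.1 hxE
          obtain ⟨d, hd, hqd⟩ := hS.used q hq
          have : d = c q.1 := Nat.pow_right_injective le_rfl (hqd.symm.trans (hE.eq q hq))
          exact Or.inl ⟨hx, this ▸ hd⟩
        · rcases hS.covers c hc hE x hx with h | h | h
          · exact absurd h hxE
          · obtain ⟨q, hq, rfl⟩ := List.mem_map.1 h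
            exact Or.inl ⟨hx, hS.hot_lt c hc hE q hq hx hxE⟩
          · exact Or.inr h
      have hcard : (P.filter fun x => c x < k).card ≤ 3 * k := by
        have := Finset.card_le_mul_card_image_of_maps_to (s := P.filter fun x => c x < k)
          (t := Finset.range k) (f := c) (fun x hx => by simpa using (Finset.mem_filter.1 hx).2) 3
          fun d _ => hc.card_le d _ ((Finset.filter_subset _ _).trans (Finset.filter_subset _ _))
            fun x hx => (Finset.mem_filter.1 hx).2
        simpa using this
      have h2 := (Finset.card_le_card hsub).trans (Finset.card_union_le _ _)
      have h3 := List.toFinset_card_le (cold.map Prod.fst)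
      rw [List.length_map] at h3
      omega
    | false =>
    cases h2 : Nat.blt (cold.length + (E.length + hot.length)) need with
    | true =>
      refine lt_of_le_of_lt ?_ (Nat.le_of_ble_eq_true h2)
      have hsub : P ⊆ (E.map Prod.fst ++ (hot.map Prod.fst ++ cold.map Prod.fst)).toFinset := by
        intro x hx
        rw [List.mem_toFinset, List.mem_append, List.mem_append]
        exact hS.covers c hc hE x hx
      have h3 := (Finset.card_le_card hsub).trans (List.toFinset_card_le _)
      simp only [List.length_append, List.length_map] at h3
      omega
    | false =>
      rw [h1, h2] at h
      simp only [cond_false] at h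
      cases hot with
      | cons e hot =>
        simp only [Bool.and_eq_true] at h
        have hcov : ∀ x, x ∈ (e :: hot).map Prod.fst ∨ x ∈ cold.map Prod.fst →
            x = e.1 ∨ x ∈ hot.map Prod.fst ∨ x ∈ cold.map Prod.fst := fun x hx => by
          rwa [List.map_cons, List.mem_cons, or_assoc] at hx
        have hsub : hot ⊆ e :: hot := List.subset_cons_self _ _
        by_cases he : e.1 ∈ P ∧ e.1 ∉ E.map Prod.fst
        · have hlt := hS.hot_lt c hc hE e List.mem_cons_self he.1 he.2
          have hm := hS.hot_sound e List.mem_cons_self c hc hE he.1 he.2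
          have hb := allColors_apply (i := 0) h.1 (Nat.zero_le _) (by omega) hm
          obtain ⟨H, C, h3, h4⟩ := exists_assign hS hsub (List.Subset.refl _) hcov le_rfl hlt
            (refute need n k (2 ^ k) ((e.1, 2 ^ c e.1) :: E))
          rw [h3] at hb
          exact ih hb h4 hc (hE.cons he.1 he.2)
        · exact ih h.2 (hS.absent hsub (List.Subset.refl _) hcov (by tauto)) hc hE
      | nil =>
      cases cold with
      | nil => simp at h
      | cons e cold =>
        simp only [Bool.and_eq_true] at h
        have hcov : ∀ x, x ∈ List.map Prod.fst ([] : List (ℕ × ℕ)) ∨ x ∈ (e :: cold).map Prod.fst →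
            x = e.1 ∨ x ∈ List.map Prod.fst ([] : List (ℕ × ℕ)) ∨ x ∈ cold.map Prod.fst := fun x hx => by
          simpa using hx
        have hsub : cold ⊆ e :: cold := List.subset_cons_self _ _
        by_cases he : e.1 ∈ P ∧ e.1 ∉ E.map Prod.fst
        -- Without loss of generality an unused colour on this edge is the first unused one.
        · obtain ⟨c, hc, hE, hle⟩ : ∃ c, IsAdmissible P c ∧ IsConsistent P E c ∧ c e.1 ≤ k := by
            rcases le_total (c e.1) k with hle | hle
            · exact ⟨c, hc, hE, hle⟩
            · have hlt := hc.lt _ he.1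
              exact ⟨_, hc.swap (hle.trans_lt hlt) hlt, hE.swap hS.used hle, by
                rw [Function.comp, Equiv.swap_apply_right]⟩
          have hm := hS.cold_sound e List.mem_cons_self c hc hE he.1 he.2
          have hb := allColors_apply (i := 0) h.1 (Nat.zero_le _) (by omega) hm
          cases hk : Nat.beq (2 ^ c e.1) (2 ^ k) with
          | true =>
            obtain ⟨H, C, h3, h4⟩ := exists_assign hS (List.Subset.refl _) hsub hcov
              (Nat.le_succ k) (Nat.lt_succ_of_le hle)
              (refute need n (k + 1) (2 ^ (k + 1)) ((e.1, 2 ^ c e.1) :: E))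
            rw [hk, cond_true, show Nat.mul 2 (2 ^ k) = 2 ^ (k + 1) from (pow_succ' 2 k).symm,
              h3] at hb
            exact ih hb h4 hc (hE.cons he.1 he.2)
          | false =>
            have hne : c e.1 ≠ k := fun h => Nat.ne_of_beq_eq_false hk (by rw [h])
            obtain ⟨H, C, h3, h4⟩ := exists_assign hS (List.Subset.refl _) hsub hcov le_rfl
              (lt_of_le_of_ne hle hne) (refute need n k (2 ^ k) ((e.1, 2 ^ c e.1) :: E))
            rw [hk, cond_false, h3] at hb
            exact ih hb h4 hc (hE.cons he.1 he.2)
        · exact ih h.2 (hS.absent (List.Subset.refl _) hsub hcov (by tauto)) hc hE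

/-! ### The starting position and the searches -/

theorem mem_pairMasks {n x : ℕ} : x ∈ pairMasks n ↔ ∃ i j, i < j ∧ j < n ∧ x = 2 ^ j + 2 ^ i := by
  simp only [pairMasks, List.mem_flatMap, List.mem_reverse, List.mem_range, List.mem_map]
  constructor
  · rintro ⟨j, hj, i, hi, rfl⟩
    exact ⟨i, j, hi, hj, rfl⟩
  · rintro ⟨i, j, hi, hj, rfl⟩
    exact ⟨j, hj, i, hi, rfl⟩

theorem card_lt_of_refuteStart {n need : ℕ} (h : refuteStart n need = true) {P : Finset ℕ}
    {c : ℕ → ℕ} (hP : ∀ x ∈ P, ∃ i j, i < j ∧ j < n ∧ x = 2 ^ j + 2 ^ i) (hc : IsAdmissible P c)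
    (h1 : 3 ∈ P) (h2 : 12 ∈ P) (h3 : 48 ∈ P) (hc1 : c 3 = 0) (hc2 : c 12 = 0) (hc3 : c 48 = 1) :
    P.card < need := by
  -- The edge 48 is still undecided here, but colour 1 is already reserved for it; `exists_assign`
  -- then decides it.
  have hS : IsState P 2 [(12, 1), (3, 1)] [] ((48, 2 ^ 60 - 1) :: undecided n) := by
    have hfull : ∀ e ∈ (48, 2 ^ 60 - 1) :: undecided n, e.2 = 2 ^ 60 - 1 := by
      rw [List.forall_mem_cons]
      refine ⟨rfl, fun e he => ?_⟩
      obtain ⟨x, -, rfl⟩ := List.mem_map.1 he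
      rfl
    refine ⟨by rw [List.forall_mem_cons]; exact ⟨⟨0, by norm_num⟩, by simpa using ⟨0, by norm_num⟩⟩,
      by simp, fun e he c hc _ hx _ => ?_, by simp, fun c _ _ x hx => ?_⟩
    · rw [hfull e he, and_two_pow_ne_zero_iff, Nat.testBit_two_pow_sub_one]
      exact decide_eq_true (hc.lt _ hx)
    · by_cases hx' : x ∈ [48, 12, 3]
      · simp only [List.mem_cons, List.not_mem_nil, or_false] at hx'
        rcases hx' with rfl | rfl | rfl <;> simp
      · refine Or.inr (Or.inr (List.mem_map.2 ⟨(x, 2 ^ 60 - 1), List.mem_cons_of_mem _ ?_, rfl⟩))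
        exact List.mem_map_of_mem (List.mem_filter.2 ⟨mem_pairMasks.2 (hP x hx), by simpa using hx'⟩)
  obtain ⟨H, C, h4, h5⟩ := exists_assign (k' := 2) (v := 48) (g := 1) (hot := [])
    (cold := undecided n) hS (List.Subset.refl _)
    (List.subset_cons_self _ _) (fun x hx => by simpa using hx) le_rfl (by norm_num)
    (refute need 50 2 4 [(48, 2), (12, 1), (3, 1)])
  refine card_lt_of_refute (h4.symm.trans h) h5 hc ⟨by simp, ?_, ?_⟩
  · simp [h1, h2, h3]
  · simp [hc1, hc2, hc3]

theorem refuteStart_six : refuteStart 6 13 = true := by decide +kernel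

theorem refuteStart_eight : refuteStart 8 15 = true := by decide +kernel

theorem refuteStart_nine : refuteStart 9 16 = true := by decide +kernel

theorem refuteStart_ten : refuteStart 10 18 = true := by decide +kernel

/-! ### From graphs to the search -/

/-- The edges `e` and `f` have no common vertex. -/
def Apart {V : Type*} (e f : Sym2 V) : Prop :=
  ∀ x, ¬ (x ∈ e ∧ x ∈ f)

theorem Apart.symm {V : Type*} {e f : Sym2 V} (h : Apart e f) : Apart f e :=
  fun x hx => h x hx.symm

theorem apart_mk_iff {V : Type*} {a b c d : V} :
    Apart s(a, b) s(c, d) ↔ a ≠ c ∧ a ≠ d ∧ b ≠ c ∧ b ≠ d := by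
  simp only [Apart, Sym2.mem_iff]
  constructor
  · intro h
    refine ⟨?_, ?_, ?_, ?_⟩ <;> rintro rfl
    · exact h a (by simp)
    · exact h a (by simp)
    · exact h b (by simp)
    · exact h b (by simp)
  · rintro ⟨h1, h2, h3, h4⟩ x ⟨rfl | rfl, rfl | rfl⟩ <;> contradiction

theorem Apart.ne {V : Type*} {e f : Sym2 V} (h : Apart e f) : e ≠ f := by
  rintro rfl
  induction e with
  | _ a b => exact h a (by simp)

theorem IsRestricted.card_le_three {v : ℕ} {G : SimpleGraph (Fin v)} {c : Sym2 (Fin v) → ℕ}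
    (h : IsRestricted G c) {k : ℕ} {s : Finset (Sym2 (Fin v))}
    (hs : ∀ e ∈ s, e ∈ G.edgeSet ∧ c e = k) : s.card ≤ 3 := by
  rw [← Set.ncard_coe_finset]
  exact (Set.ncard_le_ncard hs (Set.toFinite _)).trans (h.card_color_le k)

theorem IsRestricted.card_le_two {v : ℕ} {G : SimpleGraph (Fin v)} {c : Sym2 (Fin v) → ℕ}
    (h : IsRestricted G c) {x : Fin v} {k : ℕ} {s : Finset (Sym2 (Fin v))}
    (hs : ∀ e ∈ s, e ∈ G.edgeSet ∧ x ∈ e ∧ c e = k) : s.card ≤ 2 := by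
  rw [← Set.ncard_coe_finset]
  exact (Set.ncard_le_ncard hs (Set.toFinite _)).trans (h.card_incident_le x k)

/-- The bitmask of an edge, for a numbering `σ` of the vertices. -/
def edgeMask {V : Type*} (σ : V → ℕ) : Sym2 V → ℕ :=
  Sym2.lift ⟨fun x y => 2 ^ σ x ||| 2 ^ σ y, fun _ _ => Nat.lor_comm _ _⟩

theorem testBit_edgeMask {V : Type*} (σ : V → ℕ) (e : Sym2 V) (i : ℕ) :
    (edgeMask σ e).testBit i = true ↔ ∃ x ∈ e, σ x = i := by
  induction e with
  | _ a b => simp [edgeMask, Nat.testBit_two_pow, Sym2.mem_iff]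

theorem testBit_edgeMask_apply {V : Type*} {σ : V → ℕ} (hσ : σ.Injective) (e : Sym2 V) (x : V) :
    (edgeMask σ e).testBit (σ x) = true ↔ x ∈ e := by
  rw [testBit_edgeMask]
  exact ⟨fun ⟨y, hy, hxy⟩ => hσ hxy ▸ hy, fun h => ⟨x, h, rfl⟩⟩

theorem edgeMask_injective {V : Type*} {σ : V → ℕ} (hσ : σ.Injective) :
    (edgeMask σ).Injective := fun e f h => Sym2.ext fun x => by
  rw [← testBit_edgeMask_apply hσ, h, testBit_edgeMask_apply hσ]

theorem edgeMask_and_eq_zero {V : Type*} {σ : V → ℕ} (hσ : σ.Injective) {e f : Sym2 V} :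
    edgeMask σ e &&& edgeMask σ f = 0 ↔ Apart e f := by
  constructor
  · intro h x hx
    have := congrArg (fun m => m.testBit (σ x)) h
    simp [(testBit_edgeMask_apply hσ e x).2 hx.1,
      (testBit_edgeMask_apply hσ f x).2 hx.2] at this
  · intro h
    refine Nat.zero_of_testBit_eq_false fun i => ?_
    rw [Nat.testBit_land, Bool.and_eq_false_iff]
    by_contra hi
    rw [not_or, Bool.not_eq_false, Bool.not_eq_false, testBit_edgeMask] at hi
    obtain ⟨⟨x, hx, rfl⟩, h2⟩ := hi
    exact h x ⟨hx, (testBit_edgeMask_apply hσ f x).1 h2⟩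

theorem exists_mem_of_edgeMask_and_ne_zero {V : Type*} {σ : V → ℕ} (hσ : σ.Injective)
    {e f g : Sym2 V} (h : edgeMask σ e &&& edgeMask σ f &&& edgeMask σ g ≠ 0) :
    ∃ x, x ∈ e ∧ x ∈ f ∧ x ∈ g := by
  obtain ⟨i, hi⟩ := Nat.exists_testBit_of_ne_zero h
  rw [Nat.testBit_land, Nat.testBit_land, Bool.and_eq_true, Bool.and_eq_true,
    testBit_edgeMask] at hi
  obtain ⟨⟨⟨x, hx, rfl⟩, h2⟩, h3⟩ := hi
  exact ⟨x, hx, (testBit_edgeMask_apply hσ f x).1 h2, (testBit_edgeMask_apply hσ g x).1 h3⟩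

theorem exists_numbering {v : ℕ} (a : Fin 6 → Fin v) (ha : a.Injective) :
    ∃ σ : Fin v → ℕ, σ.Injective ∧ (∀ x, σ x < v) ∧ ∀ i, σ (a i) = i := by
  classical
  have h6 : 6 ≤ v := by simpa using Fintype.card_le_of_injective a ha
  obtain ⟨g, hg⟩ := Finset.exists_equiv_extend_of_card_eq (α := Fin v) (t := Finset.range v)
    (by simp) (s := Finset.univ.image a) (f := fun x => ((Function.invFun a x : Fin 6) : ℕ))
    (by
      intro y hy
      simp only [Finset.mem_image, Finset.mem_univ, true_and] at hy
      obtain ⟨x, ⟨i, rfl⟩, rfl⟩ := hy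
      rw [Finset.mem_range]
      exact (Fin.is_lt _).trans_le h6)
    (by
      intro x hx y hy hxy
      simp only [Finset.coe_image, Finset.coe_univ, Set.image_univ, Set.mem_range] at hx hy
      obtain ⟨i, rfl⟩ := hx
      obtain ⟨j, rfl⟩ := hy
      simp only [Function.leftInverse_invFun ha _] at hxy
      rw [Fin.ext hxy])
  refine ⟨fun x => g x, fun x y h => g.injective (Subtype.ext h),
    fun x => Finset.mem_range.1 (g x).2, fun i => ?_⟩
  refine (hg (a i) (by simp)).trans ?_
  exact congrArg Fin.val (Function.leftInverse_invFun ha i)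

/-- Enumerate `D`, then move the images of `a` and `b` to 0 and 1 by two transpositions; the second
does not disturb 0. -/
theorem exists_recoloring {D : Finset ℕ} {n a b : ℕ} (hD : D.card ≤ n) (ha : a ∈ D) (hb : b ∈ D)
    (hab : a ≠ b) : ∃ κ : ℕ → ℕ, Set.InjOn κ D ∧ (∀ d ∈ D, κ d < n) ∧ κ a = 0 ∧ κ b = 1 := by
  classical
  have hn : 1 < n := (Finset.one_lt_card.2 ⟨a, ha, b, hb, hab⟩).trans_le hD
  set f : ℕ → ℕ := fun d => if h : d ∈ D then D.equivFin ⟨d, h⟩ else 0 with hf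
  have hinj : Set.InjOn f D := by
    intro x hx y hy hxy
    simp only [hf, dif_pos (show x ∈ D from hx), dif_pos (show y ∈ D from hy)] at hxy
    simpa using D.equivFin.injective (Fin.ext hxy)
  have hlt : ∀ d ∈ D, f d < n := fun d hd => by
    simp only [hf, dif_pos hd]
    exact (Fin.is_lt _).trans_le hD
  have hswap : ∀ i j d, i < n → j < n → d < n → Equiv.swap i j d < n := fun i j d hi hj hd => by
    rw [Equiv.swap_apply_def]
    split_ifs <;> assumption
  set s := Equiv.swap 0 (f a) with hs
  set t := Equiv.swap 1 (s (f b)) with ht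
  have hsa : s (f a) = 0 := Equiv.swap_apply_right _ _
  have hb0 : s (f b) ≠ 0 := fun h => hab (hinj ha hb (s.injective (hsa.trans h.symm)))
  have hfb := hswap 0 (f a) (f b) (by omega) (hlt a ha) (hlt b hb)
  refine ⟨fun d => t (s (f d)), fun x hx y hy hxy => hinj hx hy (s.injective (t.injective hxy)),
    fun d hd => hswap _ _ _ hn hfb (hswap _ _ _ (by omega) (hlt a ha) (hlt d hd)), ?_, ?_⟩
  · change t (s (f a)) = 0
    rw [hsa]
    exact Equiv.swap_apply_of_ne_of_ne (by omega) hb0.symm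
  · exact Equiv.swap_apply_right _ _

/-- Numbering the six endpoints 0 to 5 turns `x`, `y`, `z` into the masks 3, 12, 48, and renaming
colours gives the start of the search. At most 60 edges means that 60 colours suffice. -/
theorem ncard_lt_of_refuteStart {n need v : ℕ} (h : refuteStart n need = true) (hvn : v ≤ n)
    (hn : n.choose 2 ≤ 60) {G : SimpleGraph (Fin v)} {c : Sym2 (Fin v) → ℕ} (hR : IsRestricted G c)
    (hN : ∀ x ∈ G.edgeSet, ∀ y ∈ G.edgeSet, ∀ z ∈ G.edgeSet, Apart x y → Apart x z → Apart y z →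
      c x = c y ∨ c x = c z ∨ c y = c z)
    {x y z : Sym2 (Fin v)} (hx : x ∈ G.edgeSet) (hy : y ∈ G.edgeSet) (hz : z ∈ G.edgeSet)
    (hxy : Apart x y) (hxz : Apart x z) (hyz : Apart y z) (hcxy : c x = c y) (hcxz : c x ≠ c z) :
    G.edgeSet.ncard < need := by
  classical
  obtain ⟨σ, hσ, hσv, hx3, hy3, hz3⟩ : ∃ σ : Fin v → ℕ, σ.Injective ∧ (∀ w, σ w < v) ∧
      edgeMask σ x = 3 ∧ edgeMask σ y = 12 ∧ edgeMask σ z = 48 := by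
    induction x with | _ a0 a1 =>
    induction y with | _ a2 a3 =>
    induction z with | _ a4 a5 =>
    rw [SimpleGraph.mem_edgeSet] at hx hy hz
    have h01 := hx.ne
    have h23 := hy.ne
    have h45 := hz.ne
    rw [apart_mk_iff] at hxy hxz hyz
    obtain ⟨σ, h1, h2, h3⟩ := exists_numbering ![a0, a1, a2, a3, a4, a5] (by
      intro i j hij
      fin_cases i <;> fin_cases j <;> simp_all)
    refine ⟨σ, h1, h2, ?_, ?_, ?_⟩
    · have e1 := h3 0
      have e2 := h3 1
      simp at e1 e2
      simp [edgeMask, e1, e2]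
    · have e1 := h3 2
      have e2 := h3 3
      simp at e1 e2
      simp [edgeMask, e1, e2]
    · have e1 := h3 4
      have e2 := h3 5
      simp at e1 e2
      simp [edgeMask, e1, e2]
  have hcard : G.edgeFinset.card ≤ 60 := by
    refine G.card_edgeFinset_le_card_choose_two.trans ((Nat.choose_le_choose 2 ?_).trans hn)
    simpa using hvn
  obtain ⟨κ, hκ, hκlt, hκ0, hκ1⟩ := exists_recoloring (D := G.edgeFinset.image c) (n := 60)
    (a := c x) (b := c z) (Finset.card_image_le.trans hcard)
    (Finset.mem_image_of_mem _ (by simpa using hx))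
    (Finset.mem_image_of_mem _ (by simpa using hz)) hcxz
  have hκc : ∀ e ∈ G.edgeSet, ∀ f ∈ G.edgeSet, κ (c e) = κ (c f) → c e = c f :=
    fun e he f hf hef => hκ (Finset.mem_coe.2 (Finset.mem_image_of_mem _ (by simpa using he)))
      (Finset.mem_coe.2 (Finset.mem_image_of_mem _ (by simpa using hf))) hef
  have hm := edgeMask_injective hσ
  -- Colours are carried to masks through the inverse of the injective `edgeMask σ`; the value at
  -- other masks is irrelevant.
  obtain ⟨c', hc'⟩ : ∃ c' : ℕ → ℕ, ∀ e, c' (edgeMask σ e) = κ (c e) :=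
    ⟨fun m => if hm : ∃ e, edgeMask σ e = m then κ (c hm.choose) else 0, fun e => by
      have he : ∃ f, edgeMask σ f = edgeMask σ e := ⟨e, rfl⟩
      simp only [dif_pos he]
      rw [hm he.choose_spec]⟩
  have hmem : ∀ m, m ∈ G.edgeFinset.image (edgeMask σ) ↔ ∃ e ∈ G.edgeSet, edgeMask σ e = m := by
    simp
  have key := card_lt_of_refuteStart h (P := G.edgeFinset.image (edgeMask σ)) (c := c') ?_ ?_
    ((hmem _).2 ⟨x, hx, hx3⟩) ((hmem _).2 ⟨y, hy, hy3⟩) ((hmem _).2 ⟨z, hz, hz3⟩)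
    (by rw [← hx3, hc', hκ0]) (by rw [← hy3, hc', ← hcxy, hκ0]) (by rw [← hz3, hc', hκ1])
  · rwa [Finset.card_image_of_injective _ hm, ← Set.ncard_coe_finset,
      SimpleGraph.coe_edgeFinset] at key
  · intro m hm
    obtain ⟨e, he, rfl⟩ := (hmem _).1 hm
    induction e with | _ a b =>
    have hab : σ a ≠ σ b := fun h => (G.mem_edgeSet.1 he).ne (hσ h)
    have hor : ∀ i j : ℕ, i < j → 2 ^ j + 2 ^ i = 2 ^ j ||| 2 ^ i := fun i j hij =>
      Nat.two_pow_add_eq_or_of_lt (Nat.pow_lt_pow_right one_lt_two hij) 1 |> fun h => by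
        simpa using h
    rcases hab.lt_or_gt with hlt | hlt
    · exact ⟨σ a, σ b, hlt, (hσv b).trans_le hvn, by
        rw [hor _ _ hlt, Nat.lor_comm]; rfl⟩
    · exact ⟨σ b, σ a, hlt, (hσv a).trans_le hvn, by rw [hor _ _ hlt]; rfl⟩
  · refine ⟨fun m hm => ?_, fun m1 h1 m2 h2 m3 h3 h12 h13 h23 => ?_, fun d s hs hsd => ?_,
      fun m1 h1 m2 h2 m3 h3 h12 h13 h23 hc12 hc13 => ?_⟩
    · obtain ⟨e, he, rfl⟩ := (hmem _).1 hm
      rw [hc']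
      exact hκlt _ (Finset.mem_image_of_mem _ (by simpa using he))
    · obtain ⟨e, he, rfl⟩ := (hmem _).1 h1
      obtain ⟨f, hf, rfl⟩ := (hmem _).1 h2
      obtain ⟨g, hg, rfl⟩ := (hmem _).1 h3
      rw [edgeMask_and_eq_zero hσ] at h12 h13 h23
      rw [hc', hc', hc']
      rcases hN e he f hf g hg h12 h13 h23 with h | h | h <;> simp [h]
    · rcases s.eq_empty_or_nonempty with rfl | ⟨m, hms⟩
      · simp
      obtain ⟨e, he, rfl⟩ := (hmem _).1 (hs hms)
      obtain ⟨t, ht, rfl⟩ := Finset.subset_image_iff.1 hs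
      rw [Finset.card_image_of_injective _ hm]
      refine hR.card_le_three (k := c e) fun f hf => ?_
      have hfE : f ∈ G.edgeSet := by simpa using ht hf
      refine ⟨hfE, hκc f hfE e he ?_⟩
      rw [← hc', ← hc', hsd _ (Finset.mem_image_of_mem _ hf), hsd _ hms]
    · obtain ⟨e, he, rfl⟩ := (hmem _).1 h1
      obtain ⟨f, hf, rfl⟩ := (hmem _).1 h2
      obtain ⟨g, hg, rfl⟩ := (hmem _).1 h3
      by_contra h0
      obtain ⟨w, hwe, hwf, hwg⟩ := exists_mem_of_edgeMask_and_ne_zero hσ h0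
      rw [hc', hc'] at hc12 hc13
      have h3 := hR.card_le_two (x := w) (k := c e) (s := {e, f, g}) (by
        simp only [Finset.mem_insert, Finset.mem_singleton, forall_eq_or_imp, forall_eq]
        exact ⟨⟨he, hwe, trivial⟩, ⟨hf, hwf, (hκc _ he _ hf hc12).symm⟩,
          ⟨hg, hwg, (hκc _ he _ hg hc13).symm⟩⟩)
      rw [Finset.card_eq_three.2 ⟨e, f, g, fun h => h12 (by rw [h]), fun h => h13 (by rw [h]),
        fun h => h23 (by rw [h]), rfl⟩] at h3
      omega

/-! ### Graphs all of whose matchings of size three are monochromatic -/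

/-- For distinct `s ∈ A` and `t ∈ B`, the edges `ps`, `qt`, `uw` form a matching, so all have the
colour of `uw`. With both sets nonempty and at least four elements counted in `A` and `B` together,
two edges at one of `p`, `q` and one at the other get this colour: four edges with `uw`. -/
theorem IsRestricted.card_neighbor_le {v : ℕ} {G : SimpleGraph (Fin v)} {c : Sym2 (Fin v) → ℕ}
    (hR : IsRestricted G c)
    (hM : ∀ x ∈ G.edgeSet, ∀ y ∈ G.edgeSet, ∀ z ∈ G.edgeSet, Apart x y → Apart x z → Apart y z →
      c x = c y)
    {p q u w : Fin v} (huw : G.Adj u w) {A B : Finset (Fin v)}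
    (hA : ∀ s ∈ A, G.Adj p s) (hB : ∀ t ∈ B, G.Adj q t) (hpq : p ≠ q)
    (hp : p ≠ u ∧ p ≠ w) (hq : q ≠ u ∧ q ≠ w) (hA' : ∀ s ∈ A, s ≠ p ∧ s ≠ q ∧ s ≠ u ∧ s ≠ w)
    (hB' : ∀ t ∈ B, t ≠ p ∧ t ≠ q ∧ t ≠ u ∧ t ≠ w) :
    A.card = 0 ∨ B.card = 0 ∨ A.card + B.card ≤ 3 := by
  wlog hAB : B.card ≤ A.card generalizing p q A B
  · have hB2 : ∀ t ∈ B, t ≠ q ∧ t ≠ p ∧ t ≠ u ∧ t ≠ w := fun t ht => by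
      have := hB' t ht
      tauto
    have hA2 : ∀ t ∈ A, t ≠ q ∧ t ≠ p ∧ t ≠ u ∧ t ≠ w := fun t ht => by
      have := hA' t ht
      tauto
    rcases this hB hA hpq.symm hq hp hB2 hA2 (by omega) with h | h | h
    · exact Or.inr (Or.inl h)
    · exact Or.inl h
    · exact Or.inr (Or.inr (by omega))
  by_contra! h
  obtain ⟨h1, h2, h3⟩ := h
  have color : ∀ s ∈ A, ∀ t ∈ B, s ≠ t →
      c s(p, s) = c s(u, w) ∧ c s(q, t) = c s(u, w) := by
    intro s hs t ht hst
    obtain ⟨s1, s2, s3, s4⟩ := hA' s hs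
    obtain ⟨t1, t2, t3, t4⟩ := hB' t ht
    have e1 : Apart s(p, s) s(q, t) := apart_mk_iff.2 ⟨hpq, t1.symm, s2, hst⟩
    have e2 : Apart s(p, s) s(u, w) := apart_mk_iff.2 ⟨hp.1, hp.2, s3, s4⟩
    have e3 : Apart s(q, t) s(u, w) := apart_mk_iff.2 ⟨hq.1, hq.2, t3, t4⟩
    exact ⟨hM _ (hA s hs) _ huw _ (hB t ht) e2 e1 e3.symm,
      hM _ (hB t ht) _ huw _ (hA s hs) e3 e1.symm e2.symm⟩
  obtain ⟨s, hs, s', hs', t, ht, hss, hst, hs't, hqt⟩ :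
      ∃ s ∈ A, ∃ s' ∈ A, ∃ t ∈ B, s ≠ s' ∧ c s(p, s) = c s(u, w) ∧ c s(p, s') = c s(u, w) ∧
        c s(q, t) = c s(u, w) := by
    rcases Nat.lt_or_ge 1 B.card with hB2 | hB1
    · obtain ⟨t, ht, t', ht', htt⟩ := Finset.one_lt_card.1 hB2
      obtain ⟨s, hs, s', hs', hss⟩ := Finset.one_lt_card.1 (hB2.trans_le hAB)
      have hs1 : ∀ s ∈ A, c s(p, s) = c s(u, w) := fun s hs => by
        by_cases h : s = t
        · exact (color s hs t' ht' (h ▸ htt)).1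
        · exact (color s hs t ht h).1
      refine ⟨s, hs, s', hs', t, ht, hss, hs1 s hs, hs1 s' hs', ?_⟩
      by_cases h : s = t
      · exact (color s' hs' t ht (h ▸ hss.symm)).2
      · exact (color s hs t ht h).2
    · obtain ⟨t, ht⟩ := Finset.card_pos.1 (Nat.pos_of_ne_zero h2)
      have : 1 < (A.erase t).card := by
        have := Finset.pred_card_le_card_erase (s := A) (a := t)
        omega
      obtain ⟨s, hs, s', hs', hss⟩ := Finset.one_lt_card.1 this
      rw [Finset.mem_erase] at hs hs'
      have := color s hs.2 t ht hs.1
      exact ⟨s, hs.2, s', hs'.2, t, ht, hss, this.1, (color s' hs'.2 t ht hs'.1).1, this.2⟩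
  obtain ⟨s1, s2, s3, s4⟩ := hA' s hs
  obtain ⟨s1', s2', s3', s4'⟩ := hA' s' hs'
  obtain ⟨t1, t2, t3, t4⟩ := hB' t ht
  have h4 := hR.card_le_three (k := c s(u, w)) (s := {s(u, w), s(p, s), s(p, s'), s(q, t)}) (by
    intro e he
    simp only [Finset.mem_insert, Finset.mem_singleton] at he
    rcases he with rfl | rfl | rfl | rfl
    · exact ⟨huw, rfl⟩
    · exact ⟨hA s hs, hst⟩
    · exact ⟨hA s' hs', hs't⟩
    · exact ⟨hB t ht, hqt⟩)
  rw [Finset.card_insert_of_notMem, Finset.card_insert_of_notMem, Finset.card_insert_of_notMem,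
    Finset.card_singleton] at h4
  · omega
  all_goals
    simp only [Finset.mem_insert, Finset.mem_singleton, Sym2.eq_iff]
    grind

/-- An edge avoiding both `x` and `y` would complete a matching of size three with two colours, so
all edges meet the set `S` of their four endpoints. `card_neighbor_le` limits the edges leaving `S`.
-/
theorem IsRestricted.ncard_le_of_monochromatic {v : ℕ} {G : SimpleGraph (Fin v)}
    {c : Sym2 (Fin v) → ℕ} (hR : IsRestricted G c)
    (hM : ∀ x ∈ G.edgeSet, ∀ y ∈ G.edgeSet, ∀ z ∈ G.edgeSet, Apart x y → Apart x z → Apart y z →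
      c x = c y)
    {x y : Sym2 (Fin v)} (hx : x ∈ G.edgeSet) (hy : y ∈ G.edgeSet) (hxy : Apart x y)
    (hc : c x ≠ c y) : G.edgeSet.ncard ≤ max 12 (2 * v - 3) := by
  classical
  induction x with | _ a1 a2 =>
  induction y with | _ b1 b2 =>
  rw [SimpleGraph.mem_edgeSet] at hx hy
  have ha := hx.ne
  have hb := hy.ne
  have hdis := apart_mk_iff.1 hxy
  obtain ⟨h11, h12, h21, h22⟩ := hdis
  set S : Finset (Fin v) := {a1, a2, b1, b2} with hS
  have hS4 : S.card = 4 := by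
    rw [hS, Finset.card_insert_of_notMem, Finset.card_insert_of_notMem,
      Finset.card_insert_of_notMem, Finset.card_singleton] <;> simp <;> tauto
  have hv : 4 ≤ v := by
    have := Finset.card_le_univ S
    rwa [hS4, Fintype.card_fin] at this
  set N : Fin v → Finset (Fin v) := fun p => G.neighborFinset p \ S with hN
  have hNcard : ∀ p, (N p).card ≤ v - 4 := fun p => by
    have : N p ⊆ Sᶜ := fun x hx => by
      rw [Finset.mem_compl]
      exact (Finset.mem_sdiff.1 hx).2
    have := Finset.card_le_card this
    rwa [Finset.card_compl, Fintype.card_fin, hS4] at this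
  have hNadj : ∀ p, ∀ s ∈ N p, G.Adj p s := fun p s hs => by
    simpa using (Finset.mem_sdiff.1 hs).1
  have key : ∀ p q u w, G.Adj u w → p ≠ q → (p ≠ u ∧ p ≠ w) → (q ≠ u ∧ q ≠ w) → p ∈ S → q ∈ S →
      u ∈ S → w ∈ S → (N p).card = 0 ∨ (N q).card = 0 ∨ (N p).card + (N q).card ≤ 3 := by
    intro p q u w huw hpq hp hq hpS hqS huS hwS
    have hne : ∀ r, ∀ s ∈ N r, s ≠ p ∧ s ≠ q ∧ s ≠ u ∧ s ≠ w := fun r s hs => by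
      have : ∀ z ∈ S, s ≠ z := fun z hz h => (Finset.mem_sdiff.1 hs).2 (h ▸ hz)
      exact ⟨this p hpS, this q hqS, this u huS, this w hwS⟩
    exact hR.card_neighbor_le hM huw (hNadj p) (hNadj q) hpq hp hq (hne p) (hne q)
  set T : Finset (Sym2 (Fin v)) := {s(a1, a2), s(b1, b2), s(a1, b1), s(a1, b2), s(a2, b1),
    s(a2, b2)} with hT
  have hcount : G.edgeSet.ncard ≤ (T.filter (· ∈ G.edgeSet)).card + ((N a1).card + (N a2).card +
      ((N b1).card + (N b2).card)) := by
    have hE : G.edgeSet.ncard = G.edgeFinset.card := by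
      rw [← SimpleGraph.coe_edgeFinset, Set.ncard_coe_finset]
    refine hE.trans_le ?_
    have hsub : G.edgeFinset ⊆ T.filter (· ∈ G.edgeSet) ∪
        (((N a1).image (fun r => s(a1, r)) ∪ (N a2).image (fun r => s(a2, r))) ∪
        ((N b1).image (fun r => s(b1, r)) ∪ (N b2).image (fun r => s(b2, r)))) := by
      intro e he
      induction e with | _ p q =>
      rw [SimpleGraph.mem_edgeFinset, SimpleGraph.mem_edgeSet] at he
      have hpq := he.ne
      have hex : p ∈ S ∨ q ∈ S := by
        by_contra! hn
        simp only [hS, Finset.mem_insert, Finset.mem_singleton, not_or] at hn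
        obtain ⟨⟨p1, p2, p3, p4⟩, q1, q2, q3, q4⟩ := hn
        refine hc (hM _ hx _ hy s(p, q) he hxy (apart_mk_iff.2 ?_) (apart_mk_iff.2 ?_)) <;>
          tauto
      simp only [Finset.mem_union, Finset.mem_filter, Finset.mem_image, SimpleGraph.mem_edgeSet,
        hN, Finset.mem_sdiff, SimpleGraph.mem_neighborFinset]
      by_cases hp : p ∈ S
      · by_cases hq : q ∈ S
        · refine Or.inl ⟨?_, he⟩
          simp only [hS, Finset.mem_insert, Finset.mem_singleton] at hp hq
          simp only [hT, Finset.mem_insert, Finset.mem_singleton, Sym2.eq_iff]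
          grind
        · right
          have hp' := hp
          rw [hS] at hp'
          simp only [Finset.mem_insert, Finset.mem_singleton] at hp'
          rcases hp' with rfl | rfl | rfl | rfl
          · exact Or.inl (Or.inl ⟨q, ⟨he, hq⟩, rfl⟩)
          · exact Or.inl (Or.inr ⟨q, ⟨he, hq⟩, rfl⟩)
          · exact Or.inr (Or.inl ⟨q, ⟨he, hq⟩, rfl⟩)
          · exact Or.inr (Or.inr ⟨q, ⟨he, hq⟩, rfl⟩)
      · right
        have hq' := hex.resolve_left hp
        rw [hS] at hq'
        simp only [Finset.mem_insert, Finset.mem_singleton] at hq'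
        rcases hq' with rfl | rfl | rfl | rfl
        · exact Or.inl (Or.inl ⟨p, ⟨he.symm, hp⟩, Sym2.eq_swap⟩)
        · exact Or.inl (Or.inr ⟨p, ⟨he.symm, hp⟩, Sym2.eq_swap⟩)
        · exact Or.inr (Or.inl ⟨p, ⟨he.symm, hp⟩, Sym2.eq_swap⟩)
        · exact Or.inr (Or.inr ⟨p, ⟨he.symm, hp⟩, Sym2.eq_swap⟩)
    refine (Finset.card_le_card hsub).trans ((Finset.card_union_le _ _).trans ?_)
    refine Nat.add_le_add_left ((Finset.card_union_le _ _).trans (Nat.add_le_add ?_ ?_)) _ <;>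
      exact (Finset.card_union_le _ _).trans
        (Nat.add_le_add Finset.card_image_le Finset.card_image_le)
  have hT6 : T.card ≤ 6 := Finset.card_le_six
  have hT6' := (Finset.card_filter_le T (· ∈ G.edgeSet)).trans hT6
  have hT5 : ∀ e ∈ T, e ∉ G.edgeSet → (T.filter (· ∈ G.edgeSet)).card ≤ 5 := fun e he hne =>
    Nat.le_of_lt_succ ((Finset.card_lt_card (Finset.filter_ssubset.2 ⟨e, he, hne⟩)).trans_le
      hT6)
  have cross : ∀ p q u w, p ≠ q → (p ≠ u ∧ p ≠ w) → (q ≠ u ∧ q ≠ w) → p ∈ S → q ∈ S →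
      u ∈ S → w ∈ S → s(u, w) ∈ T → (T.filter (· ∈ G.edgeSet)).card ≤ 5 ∨
      ((N p).card = 0 ∨ (N q).card = 0 ∨ (N p).card + (N q).card ≤ 3) := by
    intro p q u w hpq hp hq hpS hqS huS hwS huw
    by_cases h : G.Adj u w
    · exact Or.inr (key p q u w h hpq hp hq hpS hqS huS hwS)
    · exact Or.inl (hT5 _ huw h)
  have k1 := key a1 a2 b1 b2 hy ha ⟨h11, h12⟩ ⟨h21, h22⟩ (by simp [hS]) (by simp [hS])
    (by simp [hS]) (by simp [hS])
  have k2 := key b1 b2 a1 a2 hx hb ⟨h11.symm, h21.symm⟩ ⟨h12.symm, h22.symm⟩ (by simp [hS])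
    (by simp [hS]) (by simp [hS]) (by simp [hS])
  have k3 := cross a1 b1 a2 b2 h11 ⟨ha, h12⟩ ⟨h21.symm, hb⟩ (by simp [hS]) (by simp [hS])
    (by simp [hS]) (by simp [hS]) (by simp [hT])
  have k4 := cross a1 b2 a2 b1 h12 ⟨ha, h11⟩ ⟨h22.symm, hb.symm⟩ (by simp [hS]) (by simp [hS])
    (by simp [hS]) (by simp [hS]) (by simp [hT])
  have k5 := cross a2 b1 a1 b2 h21 ⟨ha.symm, h22⟩ ⟨h11.symm, hb⟩ (by simp [hS]) (by simp [hS])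
    (by simp [hS]) (by simp [hS]) (by simp [hT])
  have k6 := cross a2 b2 a1 b1 h22 ⟨ha.symm, h21⟩ ⟨h12.symm, hb.symm⟩ (by simp [hS])
    (by simp [hS]) (by simp [hS]) (by simp [hS]) (by simp [hT])
  have n1 := hNcard a1
  have n2 := hNcard a2
  have n3 := hNcard b1
  have n4 := hNcard b2
  rw [le_max_iff]
  clear_value N T
  -- If all six pairs in `S` are edges, every two outer neighbourhoods are constrained: either at
  -- most one is nonempty, or they total at most 6. If a pair is missing, `k1` and `k2` give at most
  -- `5 + 2 * max 3 (v - 4)`.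
  omega

/-! ### Upper bounds -/

theorem isRainbowMatching_pair {v : ℕ} {G : SimpleGraph (Fin v)} {c : Sym2 (Fin v) → ℕ}
    {x y : Sym2 (Fin v)} (hx : x ∈ G.edgeSet) (hy : y ∈ G.edgeSet) (hxy : Apart x y)
    (hc : c x ≠ c y) : IsRainbowMatching G c 2 {x, y} where
  subset_edgeSet := by simp [hx, hy]
  card_eq := Finset.card_pair hxy.ne
  disjoint := by
    have := hxy.symm
    simp only [Finset.mem_insert, Finset.mem_singleton]
    rintro e (rfl | rfl) f (rfl | rfl) h
    exacts [absurd rfl h, hxy, this, absurd rfl h]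
  rainbow := by
    simp only [Finset.mem_insert, Finset.mem_singleton]
    rintro e (rfl | rfl) f (rfl | rfl) h
    exacts [absurd rfl h, hc, hc.symm, absurd rfl h]

theorem isRainbowMatching_triple {v : ℕ} {G : SimpleGraph (Fin v)} {c : Sym2 (Fin v) → ℕ}
    {x y z : Sym2 (Fin v)} (hx : x ∈ G.edgeSet) (hy : y ∈ G.edgeSet) (hz : z ∈ G.edgeSet)
    (hxy : Apart x y) (hxz : Apart x z) (hyz : Apart y z) (hc1 : c x ≠ c y) (hc2 : c x ≠ c z)
    (hc3 : c y ≠ c z) : IsRainbowMatching G c 3 {x, y, z} where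
  subset_edgeSet := by simp [hx, hy, hz]
  card_eq := Finset.card_eq_three.2 ⟨x, y, z, hxy.ne, hxz.ne, hyz.ne, rfl⟩
  disjoint := by
    have h1 := hxy.symm
    have h2 := hxz.symm
    have h3 := hyz.symm
    simp only [Finset.mem_insert, Finset.mem_singleton]
    rintro e (rfl | rfl | rfl) f (rfl | rfl | rfl) h
    exacts [absurd rfl h, hxy, hxz, h1, absurd rfl h, hyz, h2, h3, absurd rfl h]
  rainbow := by
    simp only [Finset.mem_insert, Finset.mem_singleton]
    rintro e (rfl | rfl | rfl) f (rfl | rfl | rfl) h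
    exacts [absurd rfl h, hc1, hc2, hc1.symm, absurd rfl h, hc3, hc2.symm, hc3.symm,
      absurd rfl h]

/-! ### Graphs without a rainbow pair -/

theorem ncard_le_card_of_subset {v : ℕ} {G : SimpleGraph (Fin v)} {s : Finset (Sym2 (Fin v))}
    (h : ∀ e ∈ G.edgeSet, e ∈ s) : G.edgeSet.ncard ≤ s.card := by
  rw [← Set.ncard_coe_finset]
  exact Set.ncard_le_ncard h (Set.toFinite _)

theorem ncard_le_of_forall_mem {v : ℕ} {G : SimpleGraph (Fin v)} {a : Fin v}
    (h : ∀ e ∈ G.edgeSet, a ∈ e) : G.edgeSet.ncard ≤ v - 1 := by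
  classical
  refine (ncard_le_card_of_subset (s := (Finset.univ.erase a).image fun r => s(a, r))
    fun e he => ?_).trans (Finset.card_image_le.trans ?_)
  · obtain ⟨r, rfl⟩ := h e he
    exact Finset.mem_image_of_mem _ (by simpa using (G.mem_edgeSet.1 he).ne')
  · rw [Finset.card_erase_of_mem (Finset.mem_univ _), Finset.card_univ, Fintype.card_fin]

/-- Pairwise meeting edges form a star or a triangle: if `x` misses `a` and `y` misses `b`, then
`ab`, `x`, `y` form a triangle, and an edge meeting all its sides is a side. -/
theorem ncard_le_of_intersecting {v : ℕ} {G : SimpleGraph (Fin v)}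
    (h : ∀ x ∈ G.edgeSet, ∀ y ∈ G.edgeSet, ¬ Apart x y) : G.edgeSet.ncard ≤ max 3 (v - 1) := by
  classical
  rw [le_max_iff]
  rcases G.edgeSet.eq_empty_or_nonempty with h0 | ⟨e, he⟩
  · simp [h0]
  induction e with | _ a b =>
  by_cases ha : ∀ e ∈ G.edgeSet, a ∈ e
  · exact Or.inr (ncard_le_of_forall_mem ha)
  by_cases hb : ∀ e ∈ G.edgeSet, b ∈ e
  · exact Or.inr (ncard_le_of_forall_mem hb)
  push Not at ha hb
  obtain ⟨x, hx, hax⟩ := ha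
  obtain ⟨y, hy, hby⟩ := hb
  refine Or.inl ((ncard_le_card_of_subset (s := {s(a, b), x, y}) fun g hg => ?_).trans
    Finset.card_le_three)
  have h1 := h _ he _ hx
  have h2 := h _ he _ hy
  have h3 := h _ hx _ hy
  have h4 := h _ hg _ he
  have h5 := h _ hg _ hx
  have h6 := h _ hg _ hy
  induction x with | _ x x' =>
  induction y with | _ y y' =>
  induction g with | _ g g' =>
  have n1 := (G.mem_edgeSet.1 he).ne
  have n2 := (G.mem_edgeSet.1 hx).ne
  have n3 := (G.mem_edgeSet.1 hy).ne
  have n4 := (G.mem_edgeSet.1 hg).ne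
  rw [apart_mk_iff] at h1 h2 h3 h4 h5 h6
  simp only [Sym2.mem_iff] at hax hby
  simp only [Finset.mem_insert, Finset.mem_singleton, Sym2.eq_iff]
  clear h he hx hy hg
  grind

/-- The edges `ab`, `df`, `pq` exhaust one colour. Any other edge has a different colour, so it
meets all three; this forces it to be `qd` or `qf`. -/
theorem IsRestricted.ncard_le_five {v : ℕ} {G : SimpleGraph (Fin v)} {c : Sym2 (Fin v) → ℕ}
    (hR : IsRestricted G c) (h : ∀ x ∈ G.edgeSet, ∀ y ∈ G.edgeSet, Apart x y → c x = c y)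
    {a b d f p q : Fin v} (hab : G.Adj a b) (hdf : G.Adj d f) (hpq : G.Adj p q)
    (hx : Apart s(a, b) s(d, f)) (hp : p ≠ a ∧ p ≠ b ∧ p ≠ d ∧ p ≠ f) (hq : q ≠ d ∧ q ≠ f) :
    G.edgeSet.ncard ≤ 5 := by
  classical
  have hg : Apart s(p, q) s(d, f) := apart_mk_iff.2 ⟨hp.2.2.1, hp.2.2.2, hq.1, hq.2⟩
  refine (ncard_le_card_of_subset (s := {s(a, b), s(d, f), s(p, q), s(q, d), s(q, f)})
    fun e he => ?_).trans Finset.card_le_five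
  by_contra hne
  simp only [Finset.mem_insert, Finset.mem_singleton, not_or] at hne
  obtain ⟨n1, n2, n3, n4, n5⟩ := hne
  have key : c e ≠ c s(d, f) := fun hce => by
    have h4 := hR.card_le_three (k := c s(d, f)) (s := {e, s(a, b), s(d, f), s(p, q)}) (by
      intro e he
      simp only [Finset.mem_insert, Finset.mem_singleton] at he
      rcases he with rfl | rfl | rfl | rfl
      · exact ⟨he, hce⟩
      · exact ⟨hab, h _ hab _ hdf hx⟩
      · exact ⟨hdf, rfl⟩
      · exact ⟨hpq, h _ hpq _ hdf hg⟩)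
    rw [Finset.card_insert_of_notMem (by simp [n1, n2, n3]),
      Finset.card_insert_of_notMem, Finset.card_insert_of_notMem,
      Finset.card_singleton] at h4
    · omega
    · simpa using hg.ne.symm
    · simp only [Finset.mem_insert, Finset.mem_singleton, not_or]
      refine ⟨hx.ne, fun h => ?_⟩
      rw [Sym2.eq_iff] at h
      grind
  have k1 : ¬ Apart e s(d, f) := fun hA => key (h _ he _ hdf hA)
  have k2 : ¬ Apart e s(a, b) := fun hA => key ((h _ he _ hab hA).trans (h _ hab _ hdf hx))
  have k3 : ¬ Apart e s(p, q) := fun hA => key ((h _ he _ hpq hA).trans (h _ hpq _ hdf hg))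
  have m1 := hab.ne
  have m2 := hdf.ne
  have m3 := hpq.ne
  induction e with | _ r t =>
  have m4 := (G.mem_edgeSet.1 he).ne
  rw [apart_mk_iff] at k1 k2 k3 hx
  rw [Sym2.eq_iff] at n1 n2 n3 n4 n5
  clear key hR h hab hdf hpq he hg
  grind

theorem IsRestricted.ncard_le_of_no_rainbow_pair {v : ℕ} {G : SimpleGraph (Fin v)}
    {c : Sym2 (Fin v) → ℕ} (hR : IsRestricted G c)
    (h : ∀ x ∈ G.edgeSet, ∀ y ∈ G.edgeSet, Apart x y → c x = c y) :
    G.edgeSet.ncard ≤ max 6 (v - 1) := by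
  classical
  by_cases hA : ∀ x ∈ G.edgeSet, ∀ y ∈ G.edgeSet, ¬ Apart x y
  · exact (ncard_le_of_intersecting hA).trans (max_le_max_right _ (by norm_num))
  push Not at hA
  obtain ⟨x, hx, y, hy, hxy⟩ := hA
  induction x with | _ a b =>
  induction y with | _ d f =>
  rw [le_max_iff]
  left
  by_contra hlt
  refine hlt ((ncard_le_card_of_subset (s := {s(a, b), s(d, f), s(a, d), s(a, f), s(b, d),
    s(b, f)}) fun e he => ?_).trans Finset.card_le_six)
  have outer : ∀ p q, G.Adj p q → p = a ∨ p = b ∨ p = d ∨ p = f := by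
    intro p q hpq
    by_contra! hp
    -- The edge `pq` has an outer endpoint, so it misses one of the two disjoint edges; their roles
    -- are symmetric.
    by_cases hq : q ≠ d ∧ q ≠ f
    · have := hR.ncard_le_five h hx hy hpq hxy hp hq
      omega
    · have hq' : q ≠ a ∧ q ≠ b := by
        have := apart_mk_iff.1 hxy
        grind
      have := hR.ncard_le_five h hy hx hpq hxy.symm ⟨hp.2.2.1, hp.2.2.2, hp.1, hp.2.1⟩ hq'
      omega
  induction e with | _ p q =>
  have h1 := outer p q he
  have h2 := outer q p (G.mem_edgeSet.1 he).symm
  have h3 := (G.mem_edgeSet.1 he).ne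
  simp only [Finset.mem_insert, Finset.mem_singleton, Sym2.eq_iff]
  clear hlt outer h hR
  grind

theorem forcesRainbowMatching_one (v : ℕ) : ForcesRainbowMatching 1 v 1 := by
  intro G c _ he
  obtain ⟨e, he⟩ := Set.nonempty_of_ncard_ne_zero (Nat.one_le_iff_ne_zero.1 he)
  exact ⟨{e}, by simpa using he, by simp, by simp, by simp⟩

theorem IsRestricted.exists_rainbow_pair {v : ℕ} {G : SimpleGraph (Fin v)}
    {c : Sym2 (Fin v) → ℕ} (hR : IsRestricted G c) (h7 : 7 ≤ G.edgeSet.ncard)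
    (hv : v ≤ G.edgeSet.ncard) :
    ∃ x ∈ G.edgeSet, ∃ y ∈ G.edgeSet, Apart x y ∧ c x ≠ c y := by
  by_contra! h
  have := hR.ncard_le_of_no_rainbow_pair h
  rw [le_max_iff] at this
  omega

theorem forcesRainbowMatching_two {v e : ℕ} (h7 : 7 ≤ e) (hv : v ≤ e) :
    ForcesRainbowMatching 2 v e := by
  intro G c hR he
  obtain ⟨x, hx, y, hy, hxy, hc⟩ := hR.exists_rainbow_pair (h7.trans he) (hv.trans he)
  exact ⟨{x, y}, isRainbowMatching_pair hx hy hxy hc⟩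

/-- A matching of size three with exactly two colours is reordered so that its equally coloured
edges come first and handed to the search; otherwise the monochromatic bound applies. Hence the
thresholds 13 and `2 * v - 2`. -/
theorem forcesRainbowMatching_three {n need v : ℕ} (h : refuteStart n need = true) (hvn : v ≤ n)
    (hn : n.choose 2 ≤ 60) (h13 : 13 ≤ need) (hv : 2 * v - 2 ≤ need) (hv' : v ≤ need) :
    ForcesRainbowMatching 3 v need := by
  intro G c hR he
  by_contra hM
  have hN : ∀ x ∈ G.edgeSet, ∀ y ∈ G.edgeSet, ∀ z ∈ G.edgeSet, Apart x y → Apart x z →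
      Apart y z → c x = c y ∨ c x = c z ∨ c y = c z := by
    intro x hx y hy z hz hxy hxz hyz
    by_contra! hc
    exact hM ⟨_, isRainbowMatching_triple hx hy hz hxy hxz hyz hc.1 hc.2.1 hc.2.2⟩
  have mono : ∀ x ∈ G.edgeSet, ∀ y ∈ G.edgeSet, ∀ z ∈ G.edgeSet, Apart x y → Apart x z →
      Apart y z → c x = c y := by
    intro x hx y hy z hz hxy hxz hyz
    by_contra hc
    have key := fun {x y z} => ncard_lt_of_refuteStart h hvn hn hR hN (x := x) (y := y) (z := z)
    rcases hN x hx y hy z hz hxy hxz hyz with h1 | h1 | h1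
    · exact hc h1
    · exact he.not_gt (key hx hz hy hxz hxy hyz.symm h1 hc)
    · exact he.not_gt (key hy hz hx hyz hxy.symm hxz.symm h1 (Ne.symm hc))
  obtain ⟨x, hx, y, hy, hxy, hc⟩ := hR.exists_rainbow_pair (by omega) (hv'.trans he)
  have := hR.ncard_le_of_monochromatic mono hx hy hxy hc
  rw [le_max_iff] at this
  omega

/-! ### Lower bounds -/

theorem mu_eq_succ {l v m : ℕ} (h : ForcesRainbowMatching l v (m + 1)) {G : SimpleGraph (Fin v)}
    {c : Sym2 (Fin v) → ℕ} (hR : IsRestricted G c) (hm : m ≤ G.edgeSet.ncard)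
    (hM : ∀ M, ¬ IsRainbowMatching G c l M) : mu l v = m + 1 := by
  refine le_antisymm (Nat.sInf_le h) (le_csInf ⟨_, h⟩ fun e he => ?_)
  by_contra hlt
  obtain ⟨M, h⟩ := he G c hR (by omega)
  exact hM M h

theorem isRestricted_of_injective {v : ℕ} (G : SimpleGraph (Fin v)) {c : Sym2 (Fin v) → ℕ}
    (hc : c.Injective) : IsRestricted G c := by
  constructor
  · intro k
    refine le_trans ((Set.ncard_le_one_iff (Set.toFinite _)).2 fun ha hb => hc (ha.2.trans hb.2.symm)) (by norm_num)
  · intro x k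
    refine le_trans ((Set.ncard_le_one_iff (Set.toFinite _)).2 fun ha hb => hc (ha.2.2.trans hb.2.2.symm))
      (by norm_num)

theorem exists_injective_coloring (v : ℕ) : ∃ c : Sym2 (Fin v) → ℕ, c.Injective :=
  ⟨fun e => Fintype.equivFin _ e, fun _ _ h => (Fintype.equivFin _).injective (Fin.ext h)⟩

/-- Disjoint edges need distinct vertices of the cover `S`. -/
theorem not_isRainbowMatching_of_cover {v l : ℕ} {G : SimpleGraph (Fin v)}
    {c : Sym2 (Fin v) → ℕ} {S : Finset (Fin v)} (hS : S.card < l)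
    (hcov : ∀ e ∈ G.edgeSet, ∃ x ∈ S, x ∈ e) (M : Finset (Sym2 (Fin v))) :
    ¬ IsRainbowMatching G c l M := by
  intro h
  obtain ⟨e₀, he₀⟩ := Finset.card_pos.1 (h.card_eq ▸ (Nat.zero_le _).trans_lt hS)
  obtain ⟨x₀, -⟩ := hcov e₀ (h.subset_edgeSet e₀ he₀)
  have : Nonempty (Fin v) := ⟨x₀⟩
  choose! f hfS hfe using hcov
  refine hS.not_ge (h.card_eq ▸ Finset.card_le_card_of_injOn f
    (fun e he => hfS e (h.subset_edgeSet e he)) fun e he e' he' hee => ?_)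
  by_contra hne
  exact h.disjoint e he e' he' hne (f e) ⟨hfe e (h.subset_edgeSet e he),
    hee ▸ hfe e' (h.subset_edgeSet e' he')⟩

/-- The graph of all edges that meet `S`. -/
def coverGraph {v : ℕ} (S : Finset (Fin v)) : SimpleGraph (Fin v) where
  Adj x y := x ≠ y ∧ (x ∈ S ∨ y ∈ S)
  symm := ⟨fun _ _ h => ⟨h.1.symm, h.2.symm⟩⟩
  loopless := ⟨fun _ h => h.1 rfl⟩

theorem exists_mem_of_mem_coverGraph {v : ℕ} {S : Finset (Fin v)} :
    ∀ e ∈ (coverGraph S).edgeSet, ∃ x ∈ S, x ∈ e := by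
  intro e he
  induction e with | _ x y =>
  rcases (SimpleGraph.mem_edgeSet _).1 he with ⟨-, h | h⟩
  · exact ⟨x, h, by simp⟩
  · exact ⟨y, h, by simp⟩

theorem card_le_ncard_of_subset {v : ℕ} {G : SimpleGraph (Fin v)} {s : Finset (Sym2 (Fin v))}
    (h : ∀ e ∈ s, e ∈ G.edgeSet) : s.card ≤ G.edgeSet.ncard := by
  rw [← Set.ncard_coe_finset]
  exact Set.ncard_le_ncard h (Set.toFinite _)

theorem card_star {v : ℕ} (a : Fin v) (s : Finset (Fin v)) :
    (s.image fun r => s(a, r)).card = s.card :=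
  Finset.card_image_of_injective _ fun _ _ h => Sym2.congr_right.1 h

theorem le_ncard_coverGraph_singleton {v : ℕ} (a : Fin v) :
    v - 1 ≤ (coverGraph {a}).edgeSet.ncard := by
  classical
  have h := card_le_ncard_of_subset (G := coverGraph {a})
    (s := (Finset.univ.erase a).image fun r => s(a, r)) (by
      intro e he
      obtain ⟨r, hr, rfl⟩ := Finset.mem_image.1 he
      exact ⟨(Finset.ne_of_mem_erase hr).symm, by simp⟩)
  rwa [card_star, Finset.card_erase_of_mem (Finset.mem_univ _), Finset.card_univ,
    Fintype.card_fin] at h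

theorem le_ncard_coverGraph_pair {v : ℕ} {a b : Fin v} (hab : a ≠ b) :
    2 * v - 3 ≤ (coverGraph {a, b}).edgeSet.ncard := by
  classical
  have h := card_le_ncard_of_subset (G := coverGraph {a, b})
    (s := ((Finset.univ.erase a).image fun r => s(a, r)) ∪
      (((Finset.univ.erase a).erase b).image fun r => s(b, r))) (by
      intro e he
      rcases Finset.mem_union.1 he with he | he
      · obtain ⟨r, hr, rfl⟩ := Finset.mem_image.1 he
        exact ⟨(Finset.ne_of_mem_erase hr).symm, by simp⟩
      · obtain ⟨r, hr, rfl⟩ := Finset.mem_image.1 he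
        exact ⟨(Finset.ne_of_mem_erase hr).symm, by simp⟩)
  rw [Finset.card_union_of_disjoint, card_star, card_star,
    Finset.card_erase_of_mem (Finset.mem_univ a),
    Finset.card_erase_of_mem (Finset.mem_erase.2 ⟨hab.symm, Finset.mem_univ b⟩),
    Finset.card_erase_of_mem (Finset.mem_univ a), Finset.card_univ, Fintype.card_fin] at h
  · omega
  · rw [Finset.disjoint_left]
    intro e he he'
    obtain ⟨r, hr, rfl⟩ := Finset.mem_image.1 he
    obtain ⟨t, ht, h⟩ := Finset.mem_image.1 he'
    simp only [Finset.mem_erase, Finset.mem_univ, and_true] at hr ht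
    rw [Sym2.eq_iff] at h
    grind

/-! ### Explicit colourings for small graphs -/

/-- The edges in a list of colour classes. -/
def tableEdges {v : ℕ} (L : List (List (Sym2 (Fin v)))) : Finset (Sym2 (Fin v)) :=
  L.flatten.toFinset

/-- The index of the first colour class in `L` that contains `e`. -/
def tableColor {v : ℕ} (L : List (List (Sym2 (Fin v)))) (e : Sym2 (Fin v)) : ℕ :=
  L.findIdx fun s => e ∈ s

theorem edgeSet_fromEdgeSet_of_not_isDiag {v : ℕ} {E : Finset (Sym2 (Fin v))}
    (hE : ∀ e ∈ E, ¬ e.IsDiag) : (SimpleGraph.fromEdgeSet (E : Set (Sym2 (Fin v)))).edgeSet = E := by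
  rw [SimpleGraph.edgeSet_fromEdgeSet]
  exact sdiff_eq_left.2 (Set.disjoint_left.2 fun e he hd => hE e he hd)

/-- Only colours that occur need checking, which makes the conditions finite and decidable. -/
theorem isRestricted_fromEdgeSet {v : ℕ} {E : Finset (Sym2 (Fin v))} {c : Sym2 (Fin v) → ℕ}
    (hE : ∀ e ∈ E, ¬ e.IsDiag) (h3 : ∀ e ∈ E, (E.filter fun f => c f = c e).card ≤ 3)
    (h2 : ∀ e ∈ E, ∀ x, (E.filter fun f => x ∈ f ∧ c f = c e).card ≤ 2) :
    IsRestricted (SimpleGraph.fromEdgeSet (E : Set (Sym2 (Fin v)))) c := by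
  constructor
  · intro k
    rw [edgeSet_fromEdgeSet_of_not_isDiag hE]
    by_cases h : ∃ e ∈ E, c e = k
    · obtain ⟨e, he, rfl⟩ := h
      have := h3 e he
      rwa [← Set.ncard_coe_finset, Finset.coe_filter] at this
    · push Not at h
      rw [Set.eq_empty_of_forall_notMem (s := {e | e ∈ (E : Set (Sym2 (Fin v))) ∧ c e = k})
        fun e he => h e he.1 he.2]
      simp
  · intro x k
    rw [edgeSet_fromEdgeSet_of_not_isDiag hE]
    by_cases h : ∃ e ∈ E, c e = k
    · obtain ⟨e, he, rfl⟩ := h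
      have := h2 e he x
      rwa [← Set.ncard_coe_finset, Finset.coe_filter] at this
    · push Not at h
      rw [Set.eq_empty_of_forall_notMem
        (s := {e | e ∈ (E : Set (Sym2 (Fin v))) ∧ x ∈ e ∧ c e = k}) fun e he => h e he.1 he.2.2]
      simp

theorem mu_two_eq_of_table {v m : ℕ} (h : ForcesRainbowMatching 2 v (m + 1))
    {E : Finset (Sym2 (Fin v))} {c : Sym2 (Fin v) → ℕ} (hm : E.card = m)
    (hE : ∀ e ∈ E, ¬ e.IsDiag) (h3 : ∀ e ∈ E, (E.filter fun f => c f = c e).card ≤ 3)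
    (h2 : ∀ e ∈ E, ∀ x, (E.filter fun f => x ∈ f ∧ c f = c e).card ≤ 2)
    (hM : ∀ e ∈ E, ∀ f ∈ E, c e ≠ c f → ∃ x, x ∈ e ∧ x ∈ f) : mu 2 v = m + 1 := by
  have hedge := edgeSet_fromEdgeSet_of_not_isDiag hE
  refine mu_eq_succ h (isRestricted_fromEdgeSet hE h3 h2) ?_ fun M hR => ?_
  · rw [hedge, Set.ncard_coe_finset, hm]
  · have hsub := hR.subset_edgeSet
    simp only [hedge, Finset.mem_coe] at hsub
    obtain ⟨e, f, hef, rfl⟩ := Finset.card_eq_two.1 hR.card_eq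
    have he : e ∈ ({e, f} : Finset (Sym2 (Fin v))) := by simp
    have hf : f ∈ ({e, f} : Finset (Sym2 (Fin v))) := by simp
    obtain ⟨x, hx⟩ := hM e (hsub e he) f (hsub f hf) (hR.rainbow e he f hf hef)
    exact hR.disjoint e he f hf hef x hx

theorem mu_three_eq_of_table {v m : ℕ} (h : ForcesRainbowMatching 3 v (m + 1))
    {E : Finset (Sym2 (Fin v))} {c : Sym2 (Fin v) → ℕ} (hm : E.card = m)
    (hE : ∀ e ∈ E, ¬ e.IsDiag) (h3 : ∀ e ∈ E, (E.filter fun f => c f = c e).card ≤ 3)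
    (h2 : ∀ e ∈ E, ∀ x, (E.filter fun f => x ∈ f ∧ c f = c e).card ≤ 2)
    (hM : ∀ e ∈ E, ∀ f ∈ E, c e ≠ c f → (∀ x, ¬ (x ∈ e ∧ x ∈ f)) →
      ∀ g ∈ E, c e ≠ c g → c f ≠ c g → ∃ x, x ∈ g ∧ (x ∈ e ∨ x ∈ f)) : mu 3 v = m + 1 := by
  have hedge := edgeSet_fromEdgeSet_of_not_isDiag hE
  refine mu_eq_succ h (isRestricted_fromEdgeSet hE h3 h2) ?_ fun M hR => ?_
  · rw [hedge, Set.ncard_coe_finset, hm]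
  · have hsub := hR.subset_edgeSet
    simp only [hedge, Finset.mem_coe] at hsub
    obtain ⟨e, f, g, hef, heg, hfg, rfl⟩ := Finset.card_eq_three.1 hR.card_eq
    have he : e ∈ ({e, f, g} : Finset (Sym2 (Fin v))) := by simp
    have hf : f ∈ ({e, f, g} : Finset (Sym2 (Fin v))) := by simp
    have hg : g ∈ ({e, f, g} : Finset (Sym2 (Fin v))) := by simp
    obtain ⟨x, hxg, hx | hx⟩ := hM e (hsub e he) f (hsub f hf) (hR.rainbow e he f hf hef)
      (hR.disjoint e he f hf hef) g (hsub g hg) (hR.rainbow e he g hg heg)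
      (hR.rainbow f hf g hg hfg)
    · exact hR.disjoint e he g hg heg x ⟨hx, hxg⟩
    · exact hR.disjoint f hf g hg hfg x ⟨hx, hxg⟩

/-- The complete graph on four vertices, its perfect matchings being the colour classes. -/
def fourVertexTable (n : ℕ) : List (List (Sym2 (Fin (n + 4)))) :=
  [[s(0, 1), s(2, 3)], [s(0, 2), s(1, 3)], [s(0, 3), s(1, 2)]]

/-- A graph with 12 edges and without a rainbow matching of size three. -/
def sixVertexTable : List (List (Sym2 (Fin 6))) :=
  [[s(0, 1), s(2, 3), s(0, 4)], [s(4, 5), s(0, 5), s(1, 4)], [s(1, 5), s(2, 4), s(3, 5)],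
    [s(2, 5), s(3, 4), s(0, 3)]]

/-- A graph with 14 edges and without a rainbow matching of size three. -/
def sevenVertexTable (n : ℕ) : List (List (Sym2 (Fin (n + 7)))) :=
  [[s(0, 1), s(2, 3), s(1, 4)], [s(4, 5), s(0, 6), s(0, 4)], [s(4, 6), s(0, 5)],
    [s(2, 4), s(1, 3), s(0, 2)], [s(3, 4), s(1, 2), s(0, 3)]]

/-! ### The values of `mu` -/

theorem mu_one_eq (v : ℕ) : mu 1 v = 1 := by
  obtain ⟨c, hc⟩ := exists_injective_coloring v
  refine mu_eq_succ (m := 0) (forcesRainbowMatching_one v) (G := ⊥)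
    (isRestricted_of_injective _ hc) (Nat.zero_le _)
    (not_isRainbowMatching_of_cover (S := ∅) (by simp) (by simp))

theorem mu_two_eq_seven {v : ℕ} (h4 : 4 ≤ v) (h6 : v ≤ 6) : mu 2 v = 7 := by
  interval_cases v
  · exact mu_two_eq_of_table (forcesRainbowMatching_two (by norm_num) (by norm_num))
      (E := tableEdges (fourVertexTable 0)) (c := tableColor (fourVertexTable 0))
      (by decide +kernel) (by decide +kernel) (by decide +kernel) (by decide +kernel)
      (by decide +kernel)
  · exact mu_two_eq_of_table (forcesRainbowMatching_two (by norm_num) (by norm_num))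
      (E := tableEdges (fourVertexTable 1)) (c := tableColor (fourVertexTable 1))
      (by decide +kernel) (by decide +kernel) (by decide +kernel) (by decide +kernel)
      (by decide +kernel)
  · exact mu_two_eq_of_table (forcesRainbowMatching_two (by norm_num) (by norm_num))
      (E := tableEdges (fourVertexTable 2)) (c := tableColor (fourVertexTable 2))
      (by decide +kernel) (by decide +kernel) (by decide +kernel) (by decide +kernel)
      (by decide +kernel)

theorem mu_two_eq_self {v : ℕ} (h7 : 7 ≤ v) : mu 2 v = v := by
  obtain ⟨n, rfl⟩ : ∃ n, v = n + 1 := ⟨v - 1, by omega⟩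
  obtain ⟨c, hc⟩ := exists_injective_coloring (n + 1)
  exact mu_eq_succ (forcesRainbowMatching_two h7 le_rfl) (isRestricted_of_injective _ hc)
    (by simpa using le_ncard_coverGraph_singleton (0 : Fin (n + 1)))
    (not_isRainbowMatching_of_cover (S := {0}) (by simp) exists_mem_of_mem_coverGraph)

theorem mu_three_eq_of_refuteStart {n : ℕ} (h : refuteStart (n + 2) (2 * (n + 2) - 2) = true)
    (hn : (n + 2).choose 2 ≤ 60) (h6 : 7 ≤ n) : mu 3 (n + 2) = 2 * (n + 2) - 2 := by
  obtain ⟨c, hc⟩ := exists_injective_coloring (n + 2)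
  have hf := forcesRainbowMatching_three h le_rfl hn (by omega) le_rfl (by omega)
  have he : 2 * (n + 2) - 2 = 2 * (n + 2) - 3 + 1 := by omega
  rw [he] at hf ⊢
  refine mu_eq_succ hf (isRestricted_of_injective _ hc)
    (le_ncard_coverGraph_pair (a := 0) (b := 1) (by simp))
    (not_isRainbowMatching_of_cover (S := {0, 1}) ?_ exists_mem_of_mem_coverGraph)
  exact Finset.card_le_two.trans_lt (by norm_num)

theorem proposition7p1 :
    (∀ v : ℕ, 2 ≤ v → mu 1 v = 1) ∧
    (∀ v : ℕ, 4 ≤ v → v ≤ 6 → mu 2 v = 7) ∧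
    (∀ v : ℕ, 7 ≤ v → mu 2 v = v) ∧
    mu 3 6 = 13 ∧ mu 3 7 = 15 ∧ mu 3 8 = 15 ∧ mu 3 9 = 16 ∧ mu 3 10 = 18 := by
  refine ⟨fun v _ => mu_one_eq v, fun v => mu_two_eq_seven, fun v => mu_two_eq_self, ?_, ?_, ?_,
    mu_three_eq_of_refuteStart (n := 7) refuteStart_nine (by decide) (by norm_num),
    mu_three_eq_of_refuteStart (n := 8) refuteStart_ten (by decide) (by norm_num)⟩
  · exact mu_three_eq_of_table (forcesRainbowMatching_three refuteStart_six (by norm_num)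
      (by decide) (by norm_num) (by norm_num) (by norm_num))
      (E := tableEdges sixVertexTable) (c := tableColor sixVertexTable)
      (by decide +kernel) (by decide +kernel) (by decide +kernel) (by decide +kernel)
      (by decide +kernel)
  -- The search on eight vertices also covers seven, one vertex number being unused.
  · exact mu_three_eq_of_table (forcesRainbowMatching_three refuteStart_eight (by norm_num)
      (by decide) (by norm_num) (by norm_num) (by norm_num))
      (E := tableEdges (sevenVertexTable 0)) (c := tableColor (sevenVertexTable 0))
      (by decide +kernel) (by decide +kernel) (by decide +kernel) (by decide +kernel)
      (by decide +kernel)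
  · exact mu_three_eq_of_table (forcesRainbowMatching_three refuteStart_eight (by norm_num)
      (by decide) (by norm_num) (by norm_num) (by norm_num))
      (E := tableEdges (sevenVertexTable 1)) (c := tableColor (sevenVertexTable 1))
      (by decide +kernel) (by decide +kernel) (by decide +kernel) (by decide +kernel)
      (by decide +kernel)
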